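/- Let $M$ be a connected, paracompact, Hausdorff smooth manifold without boundary with a smooth Riemannian metric $g$, let $m>0$, and let $C=(-\Delta+m^2)^{-1}$ on $L^2(M)$ (real, with the Riemannian volume), where $-\Delta$ is the positive self-adjoint operator associated with the closure of the Dirichlet form $\int_M\langle\nabla\varphi,\nabla\chi\rangle_g\,d\mathrm{vol}$ on $C_c^\infty(M)$ (if $M$ is complete, this is the unique self-adjoint extension of $-\Delta|_{C_c^\infty(M)}$). Let $\mu$ be the Gaussian measure with covariance $C$: $\mu$ is a probability measure on a space $X$ of fields with evaluations $\Phi(f):X\to\mathbb R$, linear in $f\in C_c^\infty(M)$, such that the $\sigma$-algebra of $X$ is generated by the $\Phi(f)$ and $$\int_X e^{i\Phi(f)}\,d\mu=e^{-\frac12\langle f,Cf\rangle}\qquad(f\in C_c^\infty(M)).$$ Put $\mathcal E=L^2(X,\mu;\mathbb C)$. Wick monomials are defined by $:\!1\!:\;=1$ and $$:\!\Phi(f)\Phi(f_1)\cdots\Phi(f_k)\!:\;=\;\Phi(f)\,:\!\Phi(f_1)\cdots\Phi(f_k)\!:\;-\;\sum_{i=1}^k\langle f,Cf_i\rangle\;:\!\prod_{j\ne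 i}\Phi(f_j)\!:\,.$$ For a diffeomorphism $\psi$ of $M$, $\Gamma(\psi)$ denotes the bounded operator on $\mathcal E$ with $$\Gamma(\psi):\!\Phi(f_1)\cdots\Phi(f_k)\!:\;=\;:\!\Phi(f_1\circ\psi^{-1})\cdots\Phi(f_k\circ\psi^{-1})\!:$$ for all $k\ge 0$ and $f_1,\dots,f_k\in C_c^\infty(M)$, if there is exactly one such operator. **Theorem (Strong continuity).** Let $(\psi_n)$ be a sequence of isometries of $(M,g)$ (orientation-preserving or not) which converges to a diffeomorphism $\psi$ of $M$ in the compact-open topology. Then the operators $\Gamma(\psi_n)$ and $\Gamma(\psi)$ exist, are uniquely determined, and are unitary, and $\Gamma(\psi_n)\to\Gamma(\psi)$ in the strong operator topology: $\Gamma(\psi_n)A\to\Gamma(\psi)A$ in $\mathcal E$ for every $A\in\mathcal E$. -/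

import Mathlib

open MeasureTheory Filter Topology
open scoped Manifold ContDiff ENNReal Matrix

namespace FreeField

noncomputable section

/-- A smooth Riemannian metric on a smooth `d`-dimensional manifold `M` without boundary. -/
abbrev Metric (d : ℕ) (M : Type*) [TopologicalSpace M]
    [ChartedSpace (EuclideanSpace ℝ (Fin d)) M] [IsManifold (𝓡 d) ∞ M] :=
  Bundle.ContMDiffRiemannianMetric (𝓡 d) ∞ (EuclideanSpace ℝ (Fin d))
    (fun x : M => TangentSpace (𝓡 d) x)

/-- The real vector space of smooth real functions on `M` with compact support. -/
def TestFunctions (d : ℕ) (M : Type*) [TopologicalSpace M]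
    [ChartedSpace (EuclideanSpace ℝ (Fin d)) M] : Submodule ℝ (M → ℝ) where
  carrier := {f | ContMDiff (𝓡 d) 𝓘(ℝ, ℝ) ∞ f ∧ HasCompactSupport f}
  add_mem' := fun ha hb => ⟨ha.1.add hb.1, ha.2.add hb.2⟩
  zero_mem' := ⟨contMDiff_const, HasCompactSupport.zero⟩
  smul_mem' := fun c _ hf =>
    ⟨(contDiff_const.mul contDiff_id : ContDiff ℝ ∞ fun t : ℝ => c * t).contMDiff.comp hf.1,
      hf.2.smul_left (f := fun _ : M => c)⟩

variable {d : ℕ} {M : Type*} [TopologicalSpace M] [ChartedSpace (EuclideanSpace ℝ (Fin d)) M]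

/-- The transported function `f^ψ = f ∘ ψ⁻¹`. -/
def push (ψ : Diffeomorph (𝓡 d) (𝓡 d) M M ∞) (f : TestFunctions d M) : TestFunctions d M :=
  ⟨f.1 ∘ ψ.symm, by
    obtain ⟨f, hf⟩ := f
    exact And.intro (hf.1.comp ψ.symm.contMDiff) (hf.2.comp_homeomorph ψ.symm.toHomeomorph)⟩

variable [IsManifold (𝓡 d) ∞ M]

/-- A diffeomorphism `ψ` is an isometry of `g` if every differential `dψ_x` preserves `g`. -/
def IsIsometry (g : Metric d M) (ψ : Diffeomorph (𝓡 d) (𝓡 d) M M ∞) : Prop :=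
  ∀ (x : M) (v w : TangentSpace (𝓡 d) x),
    g.inner (ψ x) (mfderiv (𝓡 d) (𝓡 d) ψ x v) (mfderiv (𝓡 d) (𝓡 d) ψ x w) = g.inner x v w

/-! ### The Riemannian volume measure -/

/-- The coordinate vector `∂/∂xⁱ` of the chart `chartAt x₀`, at the point with coordinates `y`. -/
def coordVector (x₀ : M) (y : EuclideanSpace ℝ (Fin d)) (i : Fin d) :
    TangentSpace (𝓡 d) ((chartAt (EuclideanSpace ℝ (Fin d)) x₀).symm y) :=
  mfderiv (𝓡 d) (𝓡 d) (chartAt (EuclideanSpace ℝ (Fin d)) x₀).symm y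
    (EuclideanSpace.single i (1 : ℝ) : EuclideanSpace ℝ (Fin d))

/-- The density `√(det g_ij)` of the Riemannian volume in the chart `chartAt x₀`. -/
def volumeDensity (g : Metric d M) (x₀ : M) (y : EuclideanSpace ℝ (Fin d)) : ℝ :=
  √(Matrix.of fun i j : Fin d =>
    g.inner ((chartAt (EuclideanSpace ℝ (Fin d)) x₀).symm y)
      (coordVector x₀ y i) (coordVector x₀ y j)).det

/-- The measure `√(det g_ij) dx` on the domain of the chart `chartAt x₀`, regarded as a measure on
`M` that vanishes outside that domain. -/
def chartVolume [MeasurableSpace M] (g : Metric d M) (x₀ : M) : Measure M :=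
  (((volume : Measure (EuclideanSpace ℝ (Fin d))).restrict
      (chartAt (EuclideanSpace ℝ (Fin d)) x₀).target).withDensity
    fun y => ENNReal.ofReal (volumeDensity g x₀ y)).map
      (chartAt (EuclideanSpace ℝ (Fin d)) x₀).symm

/-- The Riemannian volume measure. The measures `chartVolume g x₀` are the restrictions of the
volume to the domains of the charts `chartAt x₀`; these domains cover `M`, so (`M` being second
countable) the volume is the least measure that dominates all of them. -/
def vol [MeasurableSpace M] (g : Metric d M) : Measure M := ⨆ x₀ : M, chartVolume g x₀

/-! ### The Laplacian and the free covariance -/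

/-- The matrix `g_ij(x)` of the metric in the standard basis of `TangentSpace (𝓡 d) x`, that is
in the coordinates of the chart `chartAt x`. -/
def gramMatrix (g : Metric d M) (x : M) : Matrix (Fin d) (Fin d) ℝ :=
  Matrix.of fun i j =>
    g.inner x (EuclideanSpace.single i (1 : ℝ) : EuclideanSpace ℝ (Fin d))
      (EuclideanSpace.single j (1 : ℝ) : EuclideanSpace ℝ (Fin d))

/-- The partial derivatives `∂_i f(x)` in the coordinates of the chart `chartAt x`. -/
def partials (f : M → ℝ) (x : M) : Fin d → ℝ := fun i =>
  (mfderiv (𝓡 d) 𝓘(ℝ, ℝ) f x (EuclideanSpace.single i (1 : ℝ) : EuclideanSpace ℝ (Fin d)) : ℝ)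

/-- The pointwise pairing `⟨∇φ, ∇χ⟩_g = g^{ij} ∂_i φ ∂_j χ`. -/
def gradInner (g : Metric d M) (φ χ : M → ℝ) (x : M) : ℝ :=
  partials φ x ⬝ᵥ (gramMatrix g x)⁻¹ *ᵥ partials χ x

variable [MeasurableSpace M]

/-- The Dirichlet form `∫_M ⟨∇φ, ∇χ⟩_g dvol`. -/
def dirichletForm (g : Metric d M) (φ χ : M → ℝ) : ℝ := ∫ x, gradInner g φ χ x ∂(vol g)

/-- `HasNegLaplacian g u h` says that `u ∈ L²(M)` is in the domain of the Laplace operator of `g`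
and `-Δ u = h ∈ L²(M)`. Here `-Δ` is the positive self-adjoint operator on `L²(M)` associated with
the closure of the Dirichlet form on `C_c^∞(M)`: `u` is an `L²`-limit of test functions `φ k` that
are Cauchy in the Dirichlet form, and `∫ ⟨∇u, ∇χ⟩ dvol = lim_k ∫ ⟨∇φ_k, ∇χ⟩ dvol = ∫ h χ dvol`
for every test function `χ`. -/
def HasNegLaplacian (g : Metric d M) (u h : M → ℝ) : Prop :=
  MemLp u 2 (vol g) ∧ MemLp h 2 (vol g) ∧
    ∃ φ : ℕ → TestFunctions d M,
      Tendsto (fun k => eLpNorm ((φ k : M → ℝ) - u) 2 (vol g)) atTop (𝓝 0) ∧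
      Tendsto (fun p : ℕ × ℕ => dirichletForm g ((φ p.1 - φ p.2 : TestFunctions d M) : M → ℝ)
        ((φ p.1 - φ p.2 : TestFunctions d M) : M → ℝ)) atTop (𝓝 0) ∧
      ∀ χ : TestFunctions d M,
        Tendsto (fun k => dirichletForm g (φ k) χ) atTop (𝓝 (∫ x, h x * χ.1 x ∂(vol g)))

/-- The free covariance `C = (-Δ + m²)⁻¹`: `C f` is the solution `u ∈ L²(M)` of `-Δ u + m² u = f`,
which exists and is unique for `f ∈ L²(M)` and `m > 0`. -/
def freeCovariance (g : Metric d M) (m : ℝ) (f : M → ℝ) : Lp ℝ 2 (vol g) :=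
  Classical.epsilon fun u : Lp ℝ 2 (vol g) =>
    HasNegLaplacian g u fun x => f x - m ^ 2 * u x

/-- The inner product `⟨f, h⟩_{-1} = ⟨f, C h⟩_{L²(M)}` of the Sobolev space `H_{-1}(M)`, on test
functions. -/
def cov (g : Metric d M) (m : ℝ) (f h : TestFunctions d M) : ℝ :=
  ∫ x, f.1 x * freeCovariance g m h.1 x ∂(vol g)

/-! ### The Gaussian measure and the operators induced by diffeomorphisms -/

/-- `μ` is the Gaussian measure with covariance `C = (-Δ + m²)⁻¹` on a space `X` of fields, where
`Φ f : X → ℝ` is the evaluation of a field at the test function `f`: the σ-algebra of `X` is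
generated by the random variables `Φ f`, and `∫ exp(i Φ(f)) dμ = exp(-⟨f, C f⟩ / 2)`. -/
structure IsFreeField (g : Metric d M) (m : ℝ) {X : Type*} [mX : MeasurableSpace X]
    (μ : Measure X) (Φ : TestFunctions d M →ₗ[ℝ] (X → ℝ)) : Prop where
  generates : mX = ⨆ f : TestFunctions d M, MeasurableSpace.comap (Φ f) inferInstance
  characteristic : ∀ f : TestFunctions d M,
    ∫ q, Complex.exp (Complex.I * (Φ f q : ℂ)) ∂μ = Complex.exp (-(cov g m f f : ℂ) / 2)

/-- The Wick-ordered monomial `:Φ(f₁) ⋯ Φ(fₙ):` with respect to the covariance `C`: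
`:Φ(f) Φ(f₁) ⋯ Φ(fₙ): = Φ(f) :Φ(f₁) ⋯ Φ(fₙ): - ∑_i ⟨f, C f_i⟩ :∏_{j ≠ i} Φ(f_j):`. -/
def wick (g : Metric d M) (m : ℝ) {X : Type*} (Φ : TestFunctions d M →ₗ[ℝ] (X → ℝ)) :
    List (TestFunctions d M) → X → ℝ
  | [] => fun _ => 1
  | f :: L => fun q => Φ f q * wick g m Φ L q -
      ∑ i : Fin L.length, cov g m f (L.get i) * wick g m Φ (L.eraseIdx i) q
  termination_by L => L.length
  decreasing_by
    · simp
    · have := i.2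
      simp only [List.length_eraseIdx, List.length_cons]
      split <;> omega

/-- The bounded operator `T` on `𝓔 = L²(X, μ; ℂ)` is induced by the diffeomorphism `ψ`:
`T :Φ(f₁) ⋯ Φ(fₙ): = :Φ(f₁^ψ) ⋯ Φ(fₙ^ψ):` for all monomials. -/
def IsInducedOperator (g : Metric d M) (m : ℝ) {X : Type*} [MeasurableSpace X] (μ : Measure X)
    (Φ : TestFunctions d M →ₗ[ℝ] (X → ℝ)) (ψ : Diffeomorph (𝓡 d) (𝓡 d) M M ∞)
    (T : Lp ℂ 2 μ →L[ℂ] Lp ℂ 2 μ) : Prop :=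
  ∀ L : List (TestFunctions d M), ∃ A B : Lp ℂ 2 μ,
    A =ᵐ[μ] (fun q => (wick g m Φ L q : ℂ)) ∧
    B =ᵐ[μ] (fun q => (wick g m Φ (L.map (push ψ)) q : ℂ)) ∧ T A = B

/-- The operator `Γ(ψ)` induced by `ψ`: the bounded operator on `𝓔` that acts on Wick monomials by
`:Φ(f₁) ⋯ Φ(fₙ): ↦ :Φ(f₁^ψ) ⋯ Φ(fₙ^ψ):`. It is meaningful for those `ψ` for which there is such
an operator; Wick monomials being total in `𝓔`, it is then unique. -/
def inducedOperator (g : Metric d M) (m : ℝ) {X : Type*} [MeasurableSpace X] (μ : Measure X)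
    (Φ : TestFunctions d M →ₗ[ℝ] (X → ℝ)) (ψ : Diffeomorph (𝓡 d) (𝓡 d) M M ∞) :
    Lp ℂ 2 μ →L[ℂ] Lp ℂ 2 μ :=
  Classical.epsilon (IsInducedOperator g m μ Φ ψ)

end

end FreeField

/-!
The operators `Γ(ψ)` are obtained as substitutions. The `σ`-algebra of `X` is generated by the field,
so `L²(X)` is the `L²` space of the law of the field configuration `f ↦ Φ(f)`, and this law is
determined by the covariance, through the one-dimensional characteristic functions
(`map_configuration_eq`). If a linear bijection `S` of the test functions preserves the covariance,
then `Φ` and `Φ ∘ S` have the same law, and replacing the one by the other in functionals of the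
field is a unitary operator (`exists_unitary_of_characteristic_invariant`). It sends `exp(iΦ(f))` to
`exp(iΦ(Sf))`, and it sends Wick monomials to Wick monomials because the coefficients of these
depend on the covariance only. Both the exponentials and the Wick monomials are total in `L²(X)`:
the former because a finite measure is determined by its characteristic functional, the latter
because the exponential series converges under the integral against a square-integrable function,
dominated by means of `exp |Φ(f)| ∈ L²`. Totality of the monomials gives uniqueness of `Γ(ψ)`;
totality of the exponentials reduces strong convergence to
`‖exp(iΦ(f)) - exp(iΦ(h))‖² = 2 - 2 exp(-⟨f - h, C(f - h)⟩ / 2)`.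

It remains to study the covariance. In the Hilbert space completion of the test functions for the
form `∫ ⟨∇φ, ∇χ⟩ dvol + m² ∫ φ χ dvol`, with its bounded map `i` to `L²(M)`, one has `C = i i†`
(`exists_inverse_of_form`); in particular `C` is everywhere defined and bounded on `L²(M)`.
Isometries preserve the volume (change of variables between charts) and the pairing of gradients
(invariance of `g^{ij} ∂_i φ ∂_j χ` under a change of frame), so that they commute with `C`.

For the limit `ψ'` it is not necessary to know that it is an isometry. If `ψ n → ψ'`, then
`f ∘ (ψ n)⁻¹ → f ∘ ψ'⁻¹` in `L²(M)` (`tendsto_toL2_push`): by invariance of the volume the distance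
is that of `f` and `f ∘ ψ'⁻¹ ∘ ψ n`, and the supports of the latter functions stay in a compact set
by a connectedness argument (`exists_compact_eventually_preimage_subset`). As `C` is bounded, the
invariance of the covariance passes to `ψ'`, and the convergence in `L²(M)` implies convergence in
the norm `⟨f, C f⟩`.
-/

namespace FreeField

noncomputable section

/-! ### Operators defined by quadratic forms -/

/-- Let `a` be a positive semidefinite form on `V`, and let `J` map `V` to a Hilbert space `L` with
`c ‖J φ‖² ≤ a φ φ`. If `H` is the Hilbert space completion of `(V, a)` and `i : H → L` extends `J`,
then `C = i i†` is the inverse of the operator of the closed form: `u = C h` holds exactly when `u`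
is the limit of an `a`-Cauchy sequence that solves the weak equation `a u χ = ⟨h, J χ⟩`. -/
theorem exists_inverse_of_form {V L : Type*} [AddCommGroup V] [Module ℝ V]
    [NormedAddCommGroup L] [InnerProductSpace ℝ L] [CompleteSpace L]
    (a : LinearMap.BilinForm ℝ V) (hsymm : ∀ φ χ, a φ χ = a χ φ) (hnonneg : ∀ φ, 0 ≤ a φ φ)
    (J : V →ₗ[ℝ] L) {c : ℝ} (hc : 0 < c) (hJ : ∀ φ, c * ‖J φ‖ ^ 2 ≤ a φ φ) :
    ∃ C : L →L[ℝ] L, ∀ h u : L, (∃ φ : ℕ → V, Tendsto (fun k => J (φ k)) atTop (𝓝 u) ∧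
      Tendsto (fun p : ℕ × ℕ => a (φ p.1 - φ p.2) (φ p.1 - φ p.2)) atTop (𝓝 0) ∧
      ∀ χ, Tendsto (fun k => a (φ k) χ) atTop (𝓝 (inner ℝ h (J χ)))) ↔ u = C h := by
  let core : PreInnerProductSpace.Core ℝ V :=
    { inner := fun φ χ => a φ χ
      conj_inner_symm := fun φ χ => by simp [hsymm φ χ]
      re_inner_nonneg := fun φ => by simpa using hnonneg φ
      add_left := fun φ χ η => by simp
      smul_left := fun φ χ r => by simp }
  let : SeminormedAddCommGroup V := InnerProductSpace.Core.toSeminormedAddCommGroup (𝕜 := ℝ)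
  let : InnerProductSpace ℝ V := InnerProductSpace.ofCore core
  have hin : ∀ φ χ : V, inner ℝ φ χ = a φ χ := fun _ _ => rfl
  have hnorm : ∀ φ : V, ‖φ‖ ^ 2 = a φ φ := fun φ => by
    rw [← real_inner_self_eq_norm_sq, hin]
  have hbound : ∀ φ : V, ‖J φ‖ ≤ √(c⁻¹) * ‖φ‖ := fun φ => by
    refine le_of_sq_le_sq ?_ (by positivity)
    rw [mul_pow, Real.sq_sqrt (by positivity), hnorm, ← div_eq_inv_mul, le_div_iff₀ hc, mul_comm]
    exact hJ φ
  let J' : V →L[ℝ] L := J.mkContinuous _ hbound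
  let e : V →L[ℝ] UniformSpace.Completion V := UniformSpace.Completion.toComplL
  have hden : DenseRange e := UniformSpace.Completion.denseRange_coe
  have hui : IsUniformInducing e := UniformSpace.Completion.isUniformInducing_coe V
  let i : UniformSpace.Completion V →L[ℝ] L := J'.extend e
  have hi : ∀ φ : V, i (e φ) = J φ := fun φ => J'.extend_eq hden hui φ
  have he : ∀ φ χ : V, inner ℝ (e φ) (e χ) = a φ χ := fun φ χ =>
    UniformSpace.Completion.inner_coe φ χ
  have henorm : ∀ φ : V, ‖e φ‖ ^ 2 = a φ φ := fun φ => by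
    rw [← real_inner_self_eq_norm_sq, he]
  have hadj : ∀ h χ, inner ℝ (i.adjoint h) (e χ) = inner ℝ h (J χ) := fun h χ => by
    rw [ContinuousLinearMap.adjoint_inner_left, hi]
  refine ⟨i ∘L i.adjoint, fun h u => ⟨?_, ?_⟩⟩
  · rintro ⟨φ, hu, hcau, hweak⟩
    have hC : CauchySeq fun k => e (φ k) := by
      rw [cauchySeq_iff_tendsto_dist_atTop_0]
      have := hcau.sqrt
      rw [Real.sqrt_zero] at this
      refine this.congr fun p => ?_
      rw [dist_eq_norm, ← map_sub, ← henorm, Real.sqrt_sq (norm_nonneg _)]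
    obtain ⟨v, hv⟩ := cauchySeq_tendsto_of_complete hC
    -- The abstract limit `v` of the sequence in the completion is `i† h`, by the weak equation.
    have huv : u = i v := by
      refine tendsto_nhds_unique hu (((i.continuous.tendsto v).comp hv).congr fun k => ?_)
      simp [hi]
    have hvh : v = i.adjoint h := by
      refine hden.eq_of_inner_left (𝕜 := ℝ) ?_
      intro χ
      rw [hadj]
      refine tendsto_nhds_unique ((hv.inner tendsto_const_nhds).congr fun k => ?_) (hweak χ)
      exact he _ _
    rw [huv, hvh]; rfl
  · rintro rfl
    obtain ⟨w, hw, hlim⟩ := mem_closure_iff_seq_limit.1 (hden (i.adjoint h))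
    choose φ hφ using hw
    obtain rfl : (fun k => e (φ k)) = w := funext hφ
    refine ⟨φ, ?_, ?_, fun χ => ?_⟩
    · refine ((i.continuous.tendsto _).comp hlim).congr fun k => ?_
      simp [hi]
    · have := (cauchySeq_iff_tendsto_dist_atTop_0.1 hlim.cauchySeq).pow 2
      simp only [ne_eq, OfNat.ofNat_ne_zero, not_false_eq_true, zero_pow] at this
      refine this.congr fun p => ?_
      rw [dist_eq_norm, ← map_sub, henorm]
    · rw [← hadj]
      exact (hlim.inner tendsto_const_nhds).congr fun k => he _ _

/-! ### Random fields and their laws -/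

section RandomField

variable {V X : Type*} [AddCommGroup V] [Module ℝ V]

/-- The field configuration at a point of `X`, as a real function on the space `V` of labels. -/
def configuration (Φ : V →ₗ[ℝ] (X → ℝ)) (q : X) : V → ℝ := fun f => Φ f q

/-- Two finite measures on a product of real lines with the same characteristic functional
coincide. -/
theorem ext_of_characteristic_pi {ι : Type*} {P Q : Measure (ι → ℝ)} [IsFiniteMeasure P]
    [IsFiniteMeasure Q]
    (h : ∀ (I : Finset ι) (t : I → ℝ),
      ∫ x, Complex.exp (((∑ j, t j * x j : ℝ) : ℂ) * Complex.I) ∂P =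
        ∫ x, Complex.exp (((∑ j, t j * x j : ℝ) : ℂ) * Complex.I) ∂Q) : P = Q := by
  classical
  refine IsProjectiveLimit.unique (P := fun I => P.map I.restrict) (fun I => rfl) (fun I => ?_)
  refine (Measure.ext_of_charFunDual (funext fun L => ?_)).symm
  have hm : Measurable (I.restrict : (ι → ℝ) → (I → ℝ)) := Finset.measurable_restrict I
  have hc : Continuous fun y : I → ℝ => Complex.exp ((L y : ℂ) * Complex.I) := by fun_prop
  have key : ∀ x : ι → ℝ, L (I.restrict x) =
      ∑ j : I, L (fun k => if j = k then 1 else 0) * x j := fun x => by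
    rw [← ContinuousLinearMap.coe_coe, LinearMap.pi_apply_eq_sum_univ]
    refine Finset.sum_congr rfl fun j _ => ?_
    rw [smul_eq_mul, mul_comm]
    rfl
  rw [charFunDual_apply, charFunDual_apply, integral_map hm.aemeasurable hc.aestronglyMeasurable,
    integral_map hm.aemeasurable hc.aestronglyMeasurable]
  simp only [key]
  exact h I _

theorem comap_configuration (Φ : V →ₗ[ℝ] (X → ℝ)) :
    MeasurableSpace.comap (configuration Φ) MeasurableSpace.pi =
      ⨆ f, MeasurableSpace.comap (Φ f) inferInstance := by
  simp only [MeasurableSpace.pi, MeasurableSpace.comap_iSup, MeasurableSpace.comap_comp]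
  rfl

variable [mX : MeasurableSpace X]

theorem measurable_configuration {Φ : V →ₗ[ℝ] (X → ℝ)} (hΦ : ∀ f, Measurable (Φ f)) :
    Measurable (configuration Φ) :=
  measurable_pi_iff.2 hΦ

/-- The law of a linear random field is determined by its one-dimensional characteristic
functions. -/
theorem map_configuration_eq {μ ν : Measure X} [IsFiniteMeasure μ] [IsFiniteMeasure ν]
    {Φ Ψ : V →ₗ[ℝ] (X → ℝ)} (hΦ : ∀ f, Measurable (Φ f)) (hΨ : ∀ f, Measurable (Ψ f))
    (h : ∀ f, ∫ q, Complex.exp (Complex.I * (Φ f q : ℂ)) ∂μ =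
      ∫ q, Complex.exp (Complex.I * (Ψ f q : ℂ)) ∂ν) :
    μ.map (configuration Φ) = ν.map (configuration Ψ) := by
  have hm := measurable_configuration hΦ
  have hm' := measurable_configuration hΨ
  refine ext_of_characteristic_pi fun I t => ?_
  have hmeas : StronglyMeasurable fun x : V → ℝ =>
      Complex.exp (((∑ j : I, t j * x j : ℝ) : ℂ) * Complex.I) := by
    refine Measurable.stronglyMeasurable ?_
    fun_prop
  rw [integral_map hm.aemeasurable hmeas.aestronglyMeasurable,
    integral_map hm'.aemeasurable hmeas.aestronglyMeasurable]
  have key : ∀ (Ξ : V →ₗ[ℝ] (X → ℝ)) q,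
      ∑ j : I, t j * configuration Ξ q j = Ξ (∑ j : I, t j • (j : V)) q := fun Ξ q => by
    simp [configuration, map_sum, Finset.sum_apply]
  simp only [key]
  simpa only [mul_comm] using h (∑ j : I, t j • (j : V))

theorem measurable_of_generates {Φ : V →ₗ[ℝ] (X → ℝ)}
    (hgen : mX = ⨆ f, MeasurableSpace.comap (Φ f) inferInstance) (f : V) : Measurable (Φ f) := by
  rw [measurable_iff_comap_le]
  conv_rhs => rw [hgen]
  exact le_iSup (fun f => MeasurableSpace.comap (Φ f) inferInstance) f

/-- When the `σ`-algebra of `X` is generated by the field, composition with the configuration map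
identifies `L²(X)` with the `L²` space of the law of the field. -/
theorem surjective_compMeasurePreserving_configuration {Φ : V →ₗ[ℝ] (X → ℝ)}
    (hgen : mX = ⨆ f, MeasurableSpace.comap (Φ f) inferInstance) {μ : Measure X}
    {P : Measure (V → ℝ)} (hP : MeasurePreserving (configuration Φ) μ P) :
    Function.Surjective (Lp.compMeasurePreservingₗᵢ ℂ (E := ℂ) (p := 2) _ hP) := by
  intro A
  have hA : StronglyMeasurable A := Lp.stronglyMeasurable A
  have hA' : StronglyMeasurable[MeasurableSpace.comap (configuration Φ) MeasurableSpace.pi] A := by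
    rw [comap_configuration, ← hgen]; exact hA
  obtain ⟨F, hF, hAF⟩ := hA'.exists_eq_measurable_comp
  have hF2 : MemLp F 2 P := by
    rw [← hP.map_eq, memLp_map_measure_iff hF.aestronglyMeasurable hP.measurable.aemeasurable,
      ← hAF]
    exact Lp.memLp A
  refine ⟨hF2.toLp F, ?_⟩
  refine Lp.ext ?_
  refine (Lp.coeFn_compMeasurePreserving _ hP).trans ?_
  refine (hP.quasiMeasurePreserving.ae_eq_comp hF2.coeFn_toLp).trans ?_
  rw [hAF]

/-- A linear bijection of the labels that leaves the characteristic functional of the field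
invariant acts unitarily on `L²(X)`, by substitution in the functionals of the field. -/
theorem exists_unitary_of_characteristic_invariant {Φ : V →ₗ[ℝ] (X → ℝ)}
    (hgen : mX = ⨆ f, MeasurableSpace.comap (Φ f) inferInstance) {μ : Measure X}
    [IsFiniteMeasure μ] (S : V ≃ₗ[ℝ] V)
    (hS : ∀ f, ∫ q, Complex.exp (Complex.I * (Φ (S f) q : ℂ)) ∂μ =
      ∫ q, Complex.exp (Complex.I * (Φ f q : ℂ)) ∂μ) :
    ∃ T : Lp ℂ 2 μ ≃ₗᵢ[ℂ] Lp ℂ 2 μ, ∀ F : (V → ℝ) → ℂ, StronglyMeasurable F →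
      ∀ A : Lp ℂ 2 μ, A =ᵐ[μ] (fun q => F (configuration Φ q)) →
        T A =ᵐ[μ] fun q => F (configuration Φ q ∘ S) := by
  have hm := measurable_of_generates hgen
  let Ψ : V →ₗ[ℝ] (X → ℝ) := Φ ∘ₗ S.toLinearMap
  have hgen' : mX = ⨆ f, MeasurableSpace.comap (Ψ f) inferInstance := by
    rw [hgen]
    exact (S.toEquiv.iSup_comp (g := fun f => MeasurableSpace.comap (Φ f) inferInstance)).symm
  have hm' : ∀ f, Measurable (Ψ f) := fun f => hm (S f)
  have hP : MeasurePreserving (configuration Φ) μ (μ.map (configuration Φ)) :=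
    (measurable_configuration hm).measurePreserving μ
  have hP' : MeasurePreserving (configuration Ψ) μ (μ.map (configuration Φ)) :=
    ⟨measurable_configuration hm', map_configuration_eq hm' hm hS⟩
  -- `J` and `J'` compose functions on the common law of `Φ` and `Φ ∘ S` with the two
  -- configuration maps; the unitary operator is `J' ∘ J⁻¹`.
  let J := LinearIsometryEquiv.ofSurjective _
    (surjective_compMeasurePreserving_configuration hgen hP)
  let J' := LinearIsometryEquiv.ofSurjective _
    (surjective_compMeasurePreserving_configuration hgen' hP')
  refine ⟨J.symm.trans J', fun F hF A hA => ?_⟩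
  have hF2 : MemLp F 2 (μ.map (configuration Φ)) := by
    rw [memLp_map_measure_iff hF.aestronglyMeasurable hP.measurable.aemeasurable]
    exact (Lp.memLp A).ae_eq hA
  have hJ : J (hF2.toLp F) = A := by
    refine Lp.ext ?_
    refine (Lp.coeFn_compMeasurePreserving _ hP).trans ?_
    exact (hP.quasiMeasurePreserving.ae_eq_comp hF2.coeFn_toLp).trans hA.symm
  rw [← hJ, LinearIsometryEquiv.trans_apply, LinearIsometryEquiv.symm_apply_apply]
  refine (Lp.coeFn_compMeasurePreserving _ hP').trans ?_
  exact hP'.quasiMeasurePreserving.ae_eq_comp hF2.coeFn_toLp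

/-- An integrable function that is orthogonal to all exponentials `exp(iΦ(f))` vanishes: its
positive and negative parts are densities of measures with the same characteristic functional. -/
theorem ae_eq_zero_of_integral_mul_exp_eq_zero
    {μ : Measure X} {Φ : V →ₗ[ℝ] (X → ℝ)}
    (hgen : mX = ⨆ f, MeasurableSpace.comap (Φ f) inferInstance) {A : X → ℝ}
    (hA : Integrable A μ)
    (h : ∀ f, ∫ q, (A q : ℂ) * Complex.exp (Complex.I * (Φ f q : ℂ)) ∂μ = 0) : A =ᵐ[μ] 0 := by
  have hm := measurable_of_generates hgen
  wlog hAm : Measurable A generalizing A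
  · obtain ⟨B, hB, hAB⟩ := hA.1.aemeasurable
    refine hAB.trans (this (hA.congr hAB) (fun f => ?_) hB)
    rw [← h f]
    exact integral_congr_ae (hAB.mono fun q hq => by simp only [hq])
  have hfin : ∀ B : X → ℝ, Integrable B μ →
      IsFiniteMeasure (μ.withDensity fun q => ENNReal.ofReal (B q)) := fun B hB =>
    isFiniteMeasure_withDensity_ofReal hB.2
  have hint : ∀ B : X → ℝ, Measurable B → ∀ f,
      ∫ q, Complex.exp (Complex.I * (Φ f q : ℂ)) ∂(μ.withDensity fun q => ENNReal.ofReal (B q)) =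
        ∫ q, ((max (B q) 0 : ℝ) : ℂ) * Complex.exp (Complex.I * (Φ f q : ℂ)) ∂μ := fun B hB f => by
    have : (fun q => ENNReal.ofReal (B q)) = fun q => ((B q).toNNReal : ℝ≥0∞) := rfl
    rw [this, integral_withDensity_eq_integral_smul hB.real_toNNReal]
    rfl
  have h1 := hfin A hA
  have h2 := hfin (-A) hA.neg
  have hexp : ∀ (B : X → ℝ), Integrable B μ → ∀ f,
      Integrable (fun q => (B q : ℂ) * Complex.exp (Complex.I * (Φ f q : ℂ))) μ := fun B hB f => by
    refine hB.ofReal.mul_bdd (c := 1) ?_ (ae_of_all _ fun q => ?_)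
    · have := hm f
      exact Measurable.aestronglyMeasurable (by fun_prop)
    · rw [mul_comm, Complex.norm_exp_ofReal_mul_I]
  have hmap := map_configuration_eq (μ := μ.withDensity fun q => ENNReal.ofReal (A q))
    (ν := μ.withDensity fun q => ENNReal.ofReal ((-A) q)) hm hm fun f => by
      rw [hint A hAm f, hint (-A) hAm.neg f, ← sub_eq_zero, ← integral_sub, ← h f]
      · refine integral_congr_ae (ae_of_all _ fun q => ?_)
        simp only [Pi.neg_apply]
        rw [← sub_mul, ← Complex.ofReal_sub, max_zero_sub_max_neg_zero_eq_self]
      · exact hexp _ hA.pos_part f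
      · exact hexp _ hA.neg.pos_part f
  -- The two densities define the same measure, as the field generates the `σ`-algebra.
  have heq : (μ.withDensity fun q => ENNReal.ofReal (A q)) =
      μ.withDensity fun q => ENNReal.ofReal ((-A) q) := by
    ext s hs
    have hs' : MeasurableSet[MeasurableSpace.comap (configuration Φ) MeasurableSpace.pi] s := by
      rw [comap_configuration, ← hgen]; exact hs
    obtain ⟨t, ht, rfl⟩ := hs'
    rw [← Measure.map_apply (measurable_configuration hm) ht, hmap,
      Measure.map_apply (measurable_configuration hm) ht]
  have hae := (withDensity_eq_iff hAm.ennreal_ofReal.aemeasurable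
    hAm.neg.ennreal_ofReal.aemeasurable
    (by
      have := measure_ne_top (μ.withDensity fun q => ENNReal.ofReal (A q)) Set.univ
      rwa [withDensity_apply _ MeasurableSet.univ, setLIntegral_univ] at this)).1 heq
  filter_upwards [hae] with q hq
  simp only [Pi.neg_apply] at hq
  change A q = 0
  rcases le_total (A q) 0 with h0 | h0
  · rw [ENNReal.ofReal_of_nonpos h0, eq_comm, ENNReal.ofReal_eq_zero] at hq
    exact le_antisymm h0 (by linarith)
  · rw [ENNReal.ofReal_of_nonpos (p := -A q) (by linarith), ENNReal.ofReal_eq_zero] at hq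
    exact le_antisymm hq h0

end RandomField

/-! ### Gaussian fields and Wick monomials -/

section Wick

variable {V : Type*}

/-- The Wick monomial of a list of labels as a function of the field configuration. -/
def wickPoly (c : V → V → ℝ) : List V → (V → ℝ) → ℝ
  | [] => fun _ => 1
  | f :: L => fun x => x f * wickPoly c L x -
      ∑ i : Fin L.length, c f (L.get i) * wickPoly c (L.eraseIdx i) x
  termination_by L => L.length
  decreasing_by
    · simp
    · have := i.2
      simp only [List.length_eraseIdx, List.length_cons]
      split <;> omega

/-- Induction along the recursion for Wick monomials. -/
theorem wick_induction {p : List V → Prop} (nil : p [])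
    (cons : ∀ f L, p L → (∀ i : Fin L.length, p (L.eraseIdx i)) → p (f :: L)) (L : List V) :
    p L := by
  induction hn : L.length using Nat.strong_induction_on generalizing L with
  | _ n ih =>
    cases L with
    | nil => exact nil
    | cons f L =>
      simp only [List.length_cons] at hn
      refine cons f L (ih _ (by omega) L rfl) fun i => ih _ ?_ _ rfl
      have := i.2
      rw [List.length_eraseIdx, if_pos this]
      omega

/-- A relabelling that preserves the covariance commutes with Wick ordering. -/
theorem wickPoly_map {c : V → V → ℝ} {S : V → V} (hS : ∀ f h, c (S f) (S h) = c f h) (L : List V)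
    (x : V → ℝ) : wickPoly c (L.map S) x = wickPoly c L (x ∘ S) := by
  induction L using wick_induction with
  | nil => simp [wickPoly]
  | cons f L hL ih =>
    rw [List.map_cons, wickPoly, wickPoly]
    simp only [hL]
    congr 1
    refine Fintype.sum_equiv (finCongr (by simp)) _ _ fun i => ?_
    have := ih (finCongr (by simp) i)
    simp only [finCongr_apply, Fin.val_cast] at this
    simp [← this, List.eraseIdx_map, hS]

theorem measurable_wickPoly (c : V → V → ℝ) (L : List V) : Measurable (wickPoly c L) := by
  induction L using wick_induction with
  | nil => rw [wickPoly]; exact measurable_const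
  | cons f L hL ih =>
    rw [wickPoly]
    exact ((measurable_pi_apply f).mul hL).sub
      (Finset.measurable_sum _ fun i _ => (ih i).const_mul _)

end Wick

section Gaussian

variable {V X : Type*} [AddCommGroup V] [Module ℝ V] [mX : MeasurableSpace X]
  {c : V → V → ℝ} {μ : Measure X} [IsProbabilityMeasure μ] {Φ : V →ₗ[ℝ] (X → ℝ)}

/-- Characteristic functions are bounded by `1`, so `exp(-c(f,f)/2) ≤ 1`. -/
theorem variance_nonneg_of_characteristic
    (hchar : ∀ f, ∫ q, Complex.exp (Complex.I * (Φ f q : ℂ)) ∂μ = Complex.exp (-(c f f : ℂ) / 2))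
    (f : V) : 0 ≤ c f f := by
  have h : ‖∫ q, Complex.exp (Complex.I * (Φ f q : ℂ)) ∂μ‖ ≤ 1 * μ.real Set.univ :=
    norm_integral_le_of_norm_le_const (ae_of_all _ fun q => by
      rw [mul_comm, Complex.norm_exp_ofReal_mul_I])
  rw [hchar, Complex.norm_exp] at h
  have h2 : (-(c f f : ℂ) / 2).re = -(c f f) / 2 := by
    rw [show (-(c f f : ℂ) / 2) = ((-(c f f) / 2 : ℝ) : ℂ) by push_cast; rfl, Complex.ofReal_re]
  rw [h2] at h
  simp only [probReal_univ, mul_one, Real.exp_le_one_iff] at h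
  linarith

theorem map_eq_gaussianReal (hΦ : ∀ f, Measurable (Φ f))
    (hquad : ∀ (t : ℝ) f, c (t • f) (t • f) = t ^ 2 * c f f)
    (hchar : ∀ f, ∫ q, Complex.exp (Complex.I * (Φ f q : ℂ)) ∂μ = Complex.exp (-(c f f : ℂ) / 2))
    (f : V) : μ.map (Φ f) = ProbabilityTheory.gaussianReal 0 (c f f).toNNReal := by
  have hp : IsProbabilityMeasure (μ.map (Φ f)) :=
    Measure.isProbabilityMeasure_map (hΦ f).aemeasurable
  refine Measure.ext_of_charFun (funext fun t => ?_)
  rw [ProbabilityTheory.charFun_gaussianReal, charFun_apply_real, integral_map (hΦ f).aemeasurable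
    (by fun_prop)]
  have h := hchar (t • f)
  rw [hquad] at h
  simp only [map_smul, Pi.smul_apply, smul_eq_mul] at h
  have h0 : ((c f f).toNNReal : ℝ) = c f f :=
    Real.coe_toNNReal _ (variance_nonneg_of_characteristic hchar f)
  rw [h0]
  convert h using 1
  · congr 1; ext q; push_cast; ring_nf
  · push_cast; ring_nf

theorem memLp_field (hΦ : ∀ f, Measurable (Φ f))
    (hquad : ∀ (t : ℝ) f, c (t • f) (t • f) = t ^ 2 * c f f)
    (hchar : ∀ f, ∫ q, Complex.exp (Complex.I * (Φ f q : ℂ)) ∂μ = Complex.exp (-(c f f : ℂ) / 2))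
    (f : V) (p : NNReal) : MemLp (Φ f) p μ := by
  have h : MemLp id (p : ℝ≥0∞) (μ.map (Φ f)) := by
    rw [map_eq_gaussianReal hΦ hquad hchar f]
    exact ProbabilityTheory.memLp_id_gaussianReal p
  exact (memLp_map_measure_iff h.1 (hΦ f).aemeasurable).1 h

theorem integrable_exp_mul_field (hΦ : ∀ f, Measurable (Φ f))
    (hquad : ∀ (t : ℝ) f, c (t • f) (t • f) = t ^ 2 * c f f)
    (hchar : ∀ f, ∫ q, Complex.exp (Complex.I * (Φ f q : ℂ)) ∂μ = Complex.exp (-(c f f : ℂ) / 2))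
    (f : V) (t : ℝ) : Integrable (fun q => Real.exp (t * Φ f q)) μ := by
  have h : Integrable (fun x => Real.exp (t * x)) (μ.map (Φ f)) := by
    rw [map_eq_gaussianReal hΦ hquad hchar f]
    exact ProbabilityTheory.integrable_exp_mul_gaussianReal t
  exact (integrable_map_measure h.1 (hΦ f).aemeasurable).1 h

theorem memLp_exp_abs_field (hΦ : ∀ f, Measurable (Φ f))
    (hquad : ∀ (t : ℝ) f, c (t • f) (t • f) = t ^ 2 * c f f)
    (hchar : ∀ f, ∫ q, Complex.exp (Complex.I * (Φ f q : ℂ)) ∂μ = Complex.exp (-(c f f : ℂ) / 2))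
    (f : V) : MemLp (fun q => Real.exp |Φ f q|) 2 μ := by
  have hm : Measurable fun q => Real.exp |Φ f q| := ((hΦ f).abs).exp
  rw [memLp_two_iff_integrable_sq hm.aestronglyMeasurable]
  refine ((integrable_exp_mul_field hΦ hquad hchar f 2).add
    (integrable_exp_mul_field hΦ hquad hchar f (-2))).mono' (hm.pow_const 2).aestronglyMeasurable
    (ae_of_all _ fun q => ?_)
  rw [Real.norm_of_nonneg (by positivity), ← Real.exp_nat_mul, Pi.add_apply]
  push_cast
  rcases abs_cases (Φ f q) with ⟨h, -⟩ | ⟨h, -⟩ <;> rw [h]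
  · linarith [Real.exp_pos (-2 * Φ f q)]
  · rw [mul_neg, ← neg_mul]
    linarith [Real.exp_pos (2 * Φ f q)]

theorem memLp_wickPoly (hΦ : ∀ f, Measurable (Φ f))
    (hquad : ∀ (t : ℝ) f, c (t • f) (t • f) = t ^ 2 * c f f)
    (hchar : ∀ f, ∫ q, Complex.exp (Complex.I * (Φ f q : ℂ)) ∂μ = Complex.exp (-(c f f : ℂ) / 2))
    (L : List V) (p : NNReal) : MemLp (fun q => wickPoly c L (configuration Φ q)) p μ := by
  induction L using wick_induction generalizing p with
  | nil => simp only [wickPoly]; exact memLp_const _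
  | cons f L hL ih =>
    simp only [wickPoly]
    refine MemLp.sub ?_ (memLp_finsetSum _ fun i _ => (ih i p).const_mul _)
    -- `Φ(f)` and the shorter monomial are in `L^{2p}`, so that their product is in `L^p`.
    have hr : ENNReal.HolderTriple ((2 * p : NNReal) : ℝ≥0∞) ((2 * p : NNReal) : ℝ≥0∞) p := by
      refine ⟨?_⟩
      have h2 : ((2 * p : NNReal) : ℝ≥0∞) = 2 * p := by push_cast; rfl
      rw [h2, ENNReal.mul_inv (by simp) (by simp), ← add_mul, ENNReal.inv_two_add_inv_two, one_mul]
    exact (hL (2 * p)).mul (memLp_field hΦ hquad hchar f (2 * p))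

/-- The exponential `exp(iΦ(f))` as an element of `L²`. -/
def expField (hΦ : ∀ f, Measurable (Φ f)) (μ : Measure X) [IsProbabilityMeasure μ] (f : V) :
    Lp ℂ 2 μ :=
  MemLp.toLp (fun q => Complex.exp (Complex.I * (Φ f q : ℂ)))
    (MemLp.of_bound (Measurable.aestronglyMeasurable (by have := hΦ f; fun_prop)) 1
      (ae_of_all _ fun q => by rw [mul_comm, Complex.norm_exp_ofReal_mul_I]))

theorem coeFn_expField (hΦ : ∀ f, Measurable (Φ f)) (f : V) :
    expField hΦ μ f =ᵐ[μ] fun q => Complex.exp (Complex.I * (Φ f q : ℂ)) :=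
  MemLp.coeFn_toLp _

theorem eq_zero_of_inner_expField_eq_zero
    (hgen : mX = ⨆ f, MeasurableSpace.comap (Φ f) inferInstance) (A : Lp ℂ 2 μ)
    (h : ∀ f, inner ℂ (expField (measurable_of_generates hgen) μ f) A = 0) : A = 0 := by
  have hm := measurable_of_generates hgen
  have hAi : Integrable A μ := (Lp.memLp A).integrable (by norm_num)
  have h1 : ∀ f, ∫ q, A q * Complex.exp (Complex.I * (Φ f q : ℂ)) ∂μ = 0 := fun f => by
    rw [← h (-f), L2.inner_def]
    refine integral_congr_ae ?_
    filter_upwards [coeFn_expField (μ := μ) hm (-f)] with q hq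
    rw [hq, RCLike.inner_apply, ← Complex.exp_conj]
    simp
  have h2 : ∀ f, ∫ q, starRingEnd ℂ (A q) * Complex.exp (Complex.I * (Φ f q : ℂ)) ∂μ = 0 :=
    fun f => by
      have h3 := congrArg (starRingEnd ℂ) (h1 (-f))
      rw [← integral_conj, map_zero] at h3
      rw [← h3]
      refine integral_congr_ae (ae_of_all _ fun q => ?_)
      simp [← Complex.exp_conj]
  have hexp : ∀ B : X → ℂ, Integrable B μ → ∀ f,
      Integrable (fun q => B q * Complex.exp (Complex.I * (Φ f q : ℂ))) μ := fun B hB f => by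
    refine hB.mul_bdd (c := 1) ?_ (ae_of_all _ fun q => ?_)
    · have := hm f
      exact Measurable.aestronglyMeasurable (by fun_prop)
    · rw [mul_comm, Complex.norm_exp_ofReal_mul_I]
  have hAc : Integrable (fun q => starRingEnd ℂ (A q)) μ :=
    (Complex.conjCLE.toContinuousLinearMap.integrable_comp hAi :)
  -- The orthogonality relations for `A` and for its conjugate combine into relations for the real
  -- and the imaginary part.
  have hre := ae_eq_zero_of_integral_mul_exp_eq_zero hgen hAi.re fun f => by
    have : ∀ q, ((RCLike.re (A q) : ℝ) : ℂ) * Complex.exp (Complex.I * (Φ f q : ℂ)) =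
        (1 / 2 : ℂ) * (A q * Complex.exp (Complex.I * (Φ f q : ℂ)) +
          starRingEnd ℂ (A q) * Complex.exp (Complex.I * (Φ f q : ℂ))) := fun q => by
      have := Complex.add_conj (A q)
      rw [← add_mul, this]; push_cast; simp; ring
    simp only [this]
    rw [integral_const_mul, integral_add (hexp _ hAi f) (hexp _ hAc f), h1, h2]
    simp
  have him := ae_eq_zero_of_integral_mul_exp_eq_zero hgen hAi.im fun f => by
    have : ∀ q, ((RCLike.im (A q) : ℝ) : ℂ) * Complex.exp (Complex.I * (Φ f q : ℂ)) =
        (1 / (2 * Complex.I) : ℂ) * (A q * Complex.exp (Complex.I * (Φ f q : ℂ)) -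
          starRingEnd ℂ (A q) * Complex.exp (Complex.I * (Φ f q : ℂ))) := fun q => by
      have := Complex.sub_conj (A q)
      rw [← sub_mul, this]; push_cast
      have hI := Complex.I_ne_zero
      field_simp
      simp
    simp only [this]
    rw [integral_const_mul, integral_sub (hexp _ hAi f) (hexp _ hAc f), h1, h2]
    simp
  rw [Lp.eq_zero_iff_ae_eq_zero]
  filter_upwards [hre, him] with q hq1 hq2
  exact Complex.ext hq1 hq2

/-- Wick monomials are total in `L²`: multiplication by `Φ(f)` preserves their span, so that a
vector orthogonal to them is orthogonal to the powers of `Φ(f)` and, by the exponential series, to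
`exp(iΦ(f))`. -/
theorem eq_zero_of_integral_mul_wickPoly_eq_zero
    (hgen : mX = ⨆ f, MeasurableSpace.comap (Φ f) inferInstance)
    (hquad : ∀ (t : ℝ) f, c (t • f) (t • f) = t ^ 2 * c f f)
    (hchar : ∀ f, ∫ q, Complex.exp (Complex.I * (Φ f q : ℂ)) ∂μ = Complex.exp (-(c f f : ℂ) / 2))
    (A : Lp ℂ 2 μ)
    (h : ∀ L, ∫ q, (starRingEnd ℂ (A q)) * (wickPoly c L (configuration Φ q) : ℂ) ∂μ = 0) :
    A = 0 := by
  have hm := measurable_of_generates hgen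
  have hA2 : MemLp (fun q => starRingEnd ℂ (A q)) 2 μ :=
    (Lp.memLp A).continuousLinearMap_comp Complex.conjCLE.toContinuousLinearMap
  have hint : ∀ w : X → ℝ, MemLp w 2 μ →
      Integrable (fun q => starRingEnd ℂ (A q) * (w q : ℂ)) μ := fun w hw =>
    hA2.integrable_mul hw.ofReal
  let W : Submodule ℝ (X → ℝ) :=
    Submodule.span ℝ (Set.range fun L q => wickPoly c L (configuration Φ q))
  have hW : ∀ w ∈ W, MemLp w 2 μ ∧ ∫ q, (starRingEnd ℂ (A q)) * (w q : ℂ) ∂μ = 0 := by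
    intro w hw
    induction hw using Submodule.span_induction with
    | mem w hw =>
      obtain ⟨L, rfl⟩ := hw
      exact ⟨memLp_wickPoly hm hquad hchar L 2, h L⟩
    | zero => exact ⟨MemLp.zero, by simp⟩
    | add v w _ _ hv hw =>
      refine ⟨hv.1.add hw.1, ?_⟩
      simp only [Pi.add_apply, Complex.ofReal_add, mul_add]
      rw [integral_add (hint v hv.1) (hint w hw.1), hv.2, hw.2, add_zero]
    | smul t w _ hw =>
      refine ⟨hw.1.const_smul t, ?_⟩
      simp only [Pi.smul_apply, smul_eq_mul, Complex.ofReal_mul, mul_left_comm]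
      rw [integral_const_mul, hw.2, mul_zero]
  have hmul : ∀ f, ∀ w ∈ W, Φ f * w ∈ W := by
    intro f w hw
    induction hw using Submodule.span_induction with
    | mem w hw =>
      obtain ⟨L, rfl⟩ := hw
      have : (Φ f * fun q => wickPoly c L (configuration Φ q)) =
          (fun q => wickPoly c (f :: L) (configuration Φ q)) + ∑ i : Fin L.length,
            c f (L.get i) • fun q => wickPoly c (L.eraseIdx i) (configuration Φ q) := by
        ext q
        rw [Pi.add_apply, wickPoly, Finset.sum_apply]
        simp [configuration]
      simp only [this]
      exact W.add_mem (Submodule.subset_span ⟨_, rfl⟩)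
        (W.sum_mem fun i _ => W.smul_mem _ (Submodule.subset_span ⟨_, rfl⟩))
    | zero => simp
    | add v w _ _ hv hw => rw [mul_add]; exact W.add_mem hv hw
    | smul t w _ hw => rw [mul_smul_comm]; exact W.smul_mem _ hw
  have hpow : ∀ f (n : ℕ), (Φ f) ^ n ∈ W := fun f n => by
    induction n with
    | zero => exact Submodule.subset_span ⟨[], by ext q; simp [wickPoly]⟩
    | succ n ih => rw [pow_succ']; exact hmul f _ ih
  refine eq_zero_of_inner_expField_eq_zero hgen A fun f => ?_
  rw [← inner_conj_symm, L2.inner_def]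
  suffices ∫ q, (starRingEnd ℂ (A q)) * Complex.exp (Complex.I * (Φ f q : ℂ)) ∂μ = 0 by
    rw [← map_zero (starRingEnd ℂ), ← this]
    congr 1
    refine integral_congr_ae ?_
    filter_upwards [coeFn_expField (μ := μ) hm f] with q hq
    rw [hq, RCLike.inner_apply, mul_comm]
  have hlim : Tendsto (fun N : ℕ => ∫ q, (starRingEnd ℂ (A q)) *
      ∑ n ∈ Finset.range N, (Complex.I * (Φ f q : ℂ)) ^ n / (n.factorial : ℂ) ∂μ) atTop
      (𝓝 (∫ q, (starRingEnd ℂ (A q)) * Complex.exp (Complex.I * (Φ f q : ℂ)) ∂μ)) := by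
    refine tendsto_integral_of_dominated_convergence (fun q => ‖A q‖ * Real.exp |Φ f q|)
      (fun N => ?_) ?_ (fun N => ae_of_all _ fun q => ?_) (ae_of_all _ fun q => ?_)
    · refine hA2.1.mul (Measurable.aestronglyMeasurable ?_)
      have := hm f
      fun_prop
    · exact (Lp.memLp A).norm.integrable_mul (memLp_exp_abs_field hm hquad hchar f)
    · rw [norm_mul, RCLike.norm_conj]
      refine mul_le_mul_of_nonneg_left ?_ (norm_nonneg _)
      refine (norm_sum_le _ _).trans ?_
      refine le_trans (le_of_eq ?_) (Real.sum_le_exp_of_nonneg (abs_nonneg (Φ f q)) N)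
      simp
    · refine Tendsto.const_mul _ ?_
      have := NormedSpace.expSeries_div_hasSum_exp (Complex.I * (Φ f q : ℂ))
      rw [← Complex.exp_eq_exp_ℂ] at this
      exact this.tendsto_sum_nat
  refine tendsto_nhds_unique hlim ?_
  refine tendsto_const_nhds.congr fun N => ?_
  have hsum : ∀ q, (starRingEnd ℂ (A q)) *
      ∑ n ∈ Finset.range N, (Complex.I * (Φ f q : ℂ)) ^ n / (n.factorial : ℂ) =
      ∑ n ∈ Finset.range N, Complex.I ^ n / (n.factorial : ℂ) *
        ((starRingEnd ℂ (A q)) * (((Φ f ^ n) q : ℝ) : ℂ)) := fun q => by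
    rw [Finset.mul_sum]
    refine Finset.sum_congr rfl fun n _ => ?_
    simp only [Pi.pow_apply, Complex.ofReal_pow]
    ring
  simp only [hsum]
  rw [integral_finsetSum _ fun n _ => (hint _ (hW _ (hpow f n)).1).const_mul _]
  refine (Finset.sum_eq_zero fun n _ => ?_).symm
  rw [integral_const_mul, (hW _ (hpow f n)).2, mul_zero]

end Gaussian

/-! ### Operators induced by symmetries of the covariance -/

section Operators

variable {V X : Type*} [AddCommGroup V] [Module ℝ V] [mX : MeasurableSpace X]
  {c : V → V → ℝ} {μ : Measure X} [IsProbabilityMeasure μ] {Φ : V →ₗ[ℝ] (X → ℝ)}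

theorem exists_unitary_wick_exp
    (hgen : mX = ⨆ f, MeasurableSpace.comap (Φ f) inferInstance)
    (hquad : ∀ (t : ℝ) f, c (t • f) (t • f) = t ^ 2 * c f f)
    (hchar : ∀ f, ∫ q, Complex.exp (Complex.I * (Φ f q : ℂ)) ∂μ = Complex.exp (-(c f f : ℂ) / 2))
    (S : V ≃ₗ[ℝ] V) (hS : ∀ f h, c (S f) (S h) = c f h) :
    ∃ T : Lp ℂ 2 μ ≃ₗᵢ[ℂ] Lp ℂ 2 μ,
      (∀ L : List V, ∃ A B : Lp ℂ 2 μ, A =ᵐ[μ] (fun q => (wickPoly c L (configuration Φ q) : ℂ)) ∧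
        B =ᵐ[μ] (fun q => (wickPoly c (L.map S) (configuration Φ q) : ℂ)) ∧ T A = B) ∧
      ∀ f, T (expField (measurable_of_generates hgen) μ f) =
        expField (measurable_of_generates hgen) μ (S f) := by
  have hm := measurable_of_generates hgen
  obtain ⟨T, hT⟩ := exists_unitary_of_characteristic_invariant hgen (μ := μ) S
    fun f => by rw [hchar, hchar, hS]
  refine ⟨T, fun L => ?_, fun f => ?_⟩
  · have hA : MemLp (fun q => (wickPoly c L (configuration Φ q) : ℂ)) 2 μ :=
      (memLp_wickPoly hm hquad hchar L 2).ofReal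
    refine ⟨hA.toLp _, T (hA.toLp _), hA.coeFn_toLp, ?_, rfl⟩
    have := hT (fun x => (wickPoly c L x : ℂ))
      (Complex.measurable_ofReal.comp (measurable_wickPoly c L)).stronglyMeasurable _ hA.coeFn_toLp
    simpa only [wickPoly_map hS] using this
  · refine Lp.ext ?_
    have := hT (fun x => Complex.exp (Complex.I * (x f : ℂ)))
      (Measurable.stronglyMeasurable (by fun_prop)) _ (coeFn_expField hm f)
    exact this.trans (coeFn_expField hm (S f)).symm

/-- Bounded operators are determined by their values on Wick monomials. -/
theorem continuousLinearMap_ext_wick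
    (hgen : mX = ⨆ f, MeasurableSpace.comap (Φ f) inferInstance)
    (hquad : ∀ (t : ℝ) f, c (t • f) (t • f) = t ^ 2 * c f f)
    (hchar : ∀ f, ∫ q, Complex.exp (Complex.I * (Φ f q : ℂ)) ∂μ = Complex.exp (-(c f f : ℂ) / 2))
    {T T' : Lp ℂ 2 μ →L[ℂ] Lp ℂ 2 μ}
    (h : ∀ L : List V, ∃ A : Lp ℂ 2 μ,
      A =ᵐ[μ] (fun q => (wickPoly c L (configuration Φ q) : ℂ)) ∧ T A = T' A) : T = T' := by
  choose A hA hTA using h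
  have hdense : Dense (Submodule.span ℂ (Set.range A) : Set (Lp ℂ 2 μ)) := by
    rw [Submodule.dense_iff_topologicalClosure_eq_top, Submodule.topologicalClosure_eq_top_iff,
      eq_bot_iff]
    intro B hB
    refine eq_zero_of_integral_mul_wickPoly_eq_zero hgen hquad hchar B fun L => ?_
    have hL := Submodule.inner_left_of_mem_orthogonal
      (Submodule.subset_span (Set.mem_range_self L)) hB
    rw [← hL, L2.inner_def]
    refine integral_congr_ae ?_
    filter_upwards [hA L] with q hq
    rw [hq, RCLike.inner_apply, mul_comm]
  refine ContinuousLinearMap.ext_on hdense ?_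
  rintro _ ⟨L, rfl⟩
  exact hTA L

theorem norm_sq_expField_sub (hΦ : ∀ f, Measurable (Φ f))
    (hchar : ∀ f, ∫ q, Complex.exp (Complex.I * (Φ f q : ℂ)) ∂μ = Complex.exp (-(c f f : ℂ) / 2))
    (f h : V) : ‖expField hΦ μ f - expField hΦ μ h‖ ^ 2 =
      2 - 2 * Real.exp (-c (f - h) (f - h) / 2) := by
  have hinner : ∀ f h, inner ℂ (expField hΦ μ h) (expField hΦ μ f) =
      ((Real.exp (-c (f - h) (f - h) / 2) : ℝ) : ℂ) := fun f h => by
    push_cast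
    rw [← hchar (f - h), L2.inner_def]
    refine integral_congr_ae ?_
    filter_upwards [coeFn_expField (μ := μ) hΦ f, coeFn_expField (μ := μ) hΦ h] with q hq hq'
    rw [hq, hq', RCLike.inner_apply, ← Complex.exp_conj, ← Complex.exp_add]
    congr 1
    simp
    ring
  have hself : ∀ f, ‖expField hΦ μ f‖ ^ 2 = 1 := fun f => by
    have h1 := hinner f f
    have h0 : c 0 0 = 0 := by
      have := hchar 0
      simp only [map_zero, Pi.zero_apply, Complex.ofReal_zero, mul_zero, Complex.exp_zero,
        integral_const, probReal_univ, one_smul] at this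
      have h2 : Real.exp (-(c 0 0) / 2) = 1 := by
        have h3 : ((Real.exp (-(c 0 0) / 2) : ℝ) : ℂ) = 1 := by push_cast; exact this.symm
        exact_mod_cast h3
      rw [Real.exp_eq_one_iff] at h2
      linarith
    rw [inner_self_eq_norm_sq_to_K, sub_self, h0] at h1
    simp only [neg_zero, zero_div, Real.exp_zero] at h1
    exact Complex.ofReal_injective (by simpa using h1)
  rw [@norm_sub_sq ℂ, hself, hself, hinner h f]
  have : c (h - f) (h - f) = c (f - h) (f - h) := by
    have h1 := hinner f h
    have h2 := hinner h f
    rw [← inner_conj_symm, h1, Complex.conj_ofReal] at h2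
    have h3 := Real.exp_injective (Complex.ofReal_injective h2)
    linarith
  rw [this, RCLike.re_eq_complex_re, Complex.ofReal_re]
  ring

/-- Isometries that converge on the exponentials `exp(iΦ(f))` converge strongly. -/
theorem tendsto_of_tendsto_expField
    (hgen : mX = ⨆ f, MeasurableSpace.comap (Φ f) inferInstance)
    {T : ℕ → Lp ℂ 2 μ ≃ₗᵢ[ℂ] Lp ℂ 2 μ} {T' : Lp ℂ 2 μ ≃ₗᵢ[ℂ] Lp ℂ 2 μ}
    (h : ∀ f, Tendsto (fun n => T n (expField (measurable_of_generates hgen) μ f)) atTop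
      (𝓝 (T' (expField (measurable_of_generates hgen) μ f)))) (A : Lp ℂ 2 μ) :
    Tendsto (fun n => T n A) atTop (𝓝 (T' A)) := by
  let E := expField (measurable_of_generates hgen) μ
  have hdense : Dense (Submodule.span ℂ (Set.range E) : Set (Lp ℂ 2 μ)) := by
    rw [Submodule.dense_iff_topologicalClosure_eq_top, Submodule.topologicalClosure_eq_top_iff,
      eq_bot_iff]
    intro B hB
    exact eq_zero_of_inner_expField_eq_zero hgen B fun f =>
      Submodule.inner_right_of_mem_orthogonal (Submodule.subset_span (Set.mem_range_self f)) hB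
  have hspan : ∀ B ∈ Submodule.span ℂ (Set.range E),
      Tendsto (fun n => T n B) atTop (𝓝 (T' B)) := by
    intro B hB
    induction hB using Submodule.span_induction with
    | mem B hB => obtain ⟨f, rfl⟩ := hB; exact h f
    | zero => simp
    | add B C _ _ hB hC => simpa only [map_add] using hB.add hC
    | smul z B _ hB => simpa only [map_smul] using hB.const_smul z
  rw [Metric.tendsto_atTop]
  intro ε hε
  obtain ⟨B, hB, hAB⟩ := Metric.mem_closure_iff.1 (hdense A) (ε / 3) (by positivity)
  obtain ⟨N, hN⟩ := Metric.tendsto_atTop.1 (hspan B hB) (ε / 3) (by positivity)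
  refine ⟨N, fun n hn => ?_⟩
  calc dist (T n A) (T' A)
      ≤ dist (T n A) (T n B) + dist (T n B) (T' B) + dist (T' B) (T' A) := dist_triangle4 _ _ _ _
    _ < ε / 3 + ε / 3 + ε / 3 := by
        rw [LinearIsometryEquiv.dist_map, LinearIsometryEquiv.dist_map, dist_comm B A]
        linarith [hN n hn]
    _ = ε := by ring

end Operators

section Manifold

variable {d : ℕ} {M : Type*} [TopologicalSpace M] [ChartedSpace (EuclideanSpace ℝ (Fin d)) M]

/-- Transport of test functions by a diffeomorphism, as a linear equivalence. -/
def pushEquiv (ψ : Diffeomorph (𝓡 d) (𝓡 d) M M ∞) : TestFunctions d M ≃ₗ[ℝ] TestFunctions d M where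
  toFun := push ψ
  map_add' _ _ := rfl
  map_smul' _ _ := rfl
  invFun := push ψ.symm
  left_inv f := Subtype.ext (funext fun x => congrArg f.1 (ψ.symm_apply_apply x))
  right_inv f := Subtype.ext (funext fun x => congrArg f.1 (ψ.apply_symm_apply x))

variable [IsManifold (𝓡 d) ∞ M] [MeasurableSpace M] {X : Type*}

theorem wick_eq_wickPoly (g : Metric d M) (m : ℝ) (Φ : TestFunctions d M →ₗ[ℝ] (X → ℝ))
    (L : List (TestFunctions d M)) (q : X) :
    wick g m Φ L q = wickPoly (cov g m) L (configuration Φ q) := by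
  induction L using wick_induction with
  | nil => simp [wick, wickPoly]
  | cons f L hL ih =>
    rw [wick, wickPoly]
    simp only [hL, ih]
    rfl

/-- The strong continuity theorem, reduced to properties of the covariance: it is invariant under
all diffeomorphisms involved, and the transported test functions converge in `H₋₁`. -/
theorem strong_continuity_of_cov {g : Metric d M} {m : ℝ} [MeasurableSpace X] {μ : Measure X}
    [IsProbabilityMeasure μ] {Φ : TestFunctions d M →ₗ[ℝ] (X → ℝ)} (hΦ : IsFreeField g m μ Φ)
    (hquad : ∀ (t : ℝ) f, cov g m (t • f) (t • f) = t ^ 2 * cov g m f f)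
    {ψ : ℕ → Diffeomorph (𝓡 d) (𝓡 d) M M ∞} {ψ' : Diffeomorph (𝓡 d) (𝓡 d) M M ∞}
    (hψ : ∀ n f h, cov g m (push (ψ n) f) (push (ψ n) h) = cov g m f h)
    (hψ' : ∀ f h, cov g m (push ψ' f) (push ψ' h) = cov g m f h)
    (hlim : ∀ f, Tendsto (fun n => cov g m (push (ψ n) f - push ψ' f) (push (ψ n) f - push ψ' f))
      atTop (𝓝 0)) :
    (∀ n, (∃! T, IsInducedOperator g m μ Φ (ψ n) T) ∧
      inducedOperator g m μ Φ (ψ n) ∈ unitary (Lp ℂ 2 μ →L[ℂ] Lp ℂ 2 μ)) ∧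
    ((∃! T, IsInducedOperator g m μ Φ ψ' T) ∧
      inducedOperator g m μ Φ ψ' ∈ unitary (Lp ℂ 2 μ →L[ℂ] Lp ℂ 2 μ)) ∧
    ∀ A : Lp ℂ 2 μ, Tendsto (fun n => inducedOperator g m μ Φ (ψ n) A) atTop
      (𝓝 (inducedOperator g m μ Φ ψ' A)) := by
  obtain ⟨hgen, hchar⟩ := hΦ
  have hm := measurable_of_generates hgen
  have key : ∀ θ : Diffeomorph (𝓡 d) (𝓡 d) M M ∞,
      (∀ f h, cov g m (push θ f) (push θ h) = cov g m f h) →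
      ∃ T : Lp ℂ 2 μ ≃ₗᵢ[ℂ] Lp ℂ 2 μ,
        ((∃! T, IsInducedOperator g m μ Φ θ T) ∧
          inducedOperator g m μ Φ θ ∈ unitary (Lp ℂ 2 μ →L[ℂ] Lp ℂ 2 μ)) ∧
        (∀ A, inducedOperator g m μ Φ θ A = T A) ∧
        ∀ f, T (expField hm μ f) = expField hm μ (push θ f) := by
    intro θ hθ
    obtain ⟨T, hT, hTexp⟩ := exists_unitary_wick_exp hgen hquad hchar (pushEquiv θ) hθ
    let T₀ : Lp ℂ 2 μ →L[ℂ] Lp ℂ 2 μ := (T : Lp ℂ 2 μ ≃L[ℂ] Lp ℂ 2 μ)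
    have hT₀ : IsInducedOperator g m μ Φ θ T₀ := fun L => by
      obtain ⟨A, B, hA, hB, hAB⟩ := hT L
      simp only [wick_eq_wickPoly]
      exact ⟨A, B, hA, hB, hAB⟩
    have huniq : ∀ T', IsInducedOperator g m μ Φ θ T' → T' = T₀ := fun T' hT' => by
      refine continuousLinearMap_ext_wick hgen hquad hchar fun L => ?_
      obtain ⟨A, B, hA, hB, hAB⟩ := hT' L
      obtain ⟨A', B', hA', hB', hAB'⟩ := hT₀ L
      refine ⟨A, ?_, ?_⟩
      · simpa only [wick_eq_wickPoly] using hA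
      · obtain rfl : A = A' := Lp.ext (hA.trans hA'.symm)
        rw [hAB, hAB']
        exact Lp.ext (hB.trans hB'.symm)
    have hind : inducedOperator g m μ Φ θ = T₀ :=
      huniq _ (Classical.epsilon_spec (p := IsInducedOperator g m μ Φ θ) ⟨T₀, hT₀⟩)
    refine ⟨T, ⟨⟨T₀, hT₀, huniq⟩, ?_⟩, fun A => by rw [hind]; rfl, hTexp⟩
    rw [hind]
    exact (Unitary.linearIsometryEquiv.symm T).2
  choose T hT hTeq hTexp using fun n => key (ψ n) (hψ n)
  obtain ⟨T', hT', hTeq', hTexp'⟩ := key ψ' hψ'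
  refine ⟨hT, hT', fun A => ?_⟩
  simp only [hTeq, hTeq']
  refine tendsto_of_tendsto_expField hgen (fun f => ?_) A
  simp only [hTexp, hTexp']
  rw [tendsto_iff_norm_sub_tendsto_zero]
  have h1 : Tendsto (fun n => √(2 - 2 * Real.exp
      (-cov g m (push (ψ n) f - push ψ' f) (push (ψ n) f - push ψ' f) / 2))) atTop
      (𝓝 √(2 - 2 * Real.exp (-0 / 2))) :=
    ((((hlim f).neg.div_const 2).rexp.const_mul 2).const_sub 2).sqrt
  simp only [neg_zero, zero_div, Real.exp_zero, mul_one, sub_self, Real.sqrt_zero] at h1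
  refine h1.congr fun n => ?_
  rw [← norm_sq_expField_sub hm hchar, Real.sqrt_sq (norm_nonneg _)]

end Manifold

/-! ### Gram matrices and gradient pairings -/

section LinearAlgebra

variable {d : ℕ}

/-- The Gram matrix of the vectors `D e_i`, for the standard basis `e_i`. -/
def gramOf (B : LinearMap.BilinForm ℝ (EuclideanSpace ℝ (Fin d)))
    (D : EuclideanSpace ℝ (Fin d) →ₗ[ℝ] EuclideanSpace ℝ (Fin d)) : Matrix (Fin d) (Fin d) ℝ :=
  Matrix.of fun i j => B (D (EuclideanSpace.single i 1)) (D (EuclideanSpace.single j 1))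

theorem gramOf_eq (B : LinearMap.BilinForm ℝ (EuclideanSpace ℝ (Fin d)))
    (D : EuclideanSpace ℝ (Fin d) →ₗ[ℝ] EuclideanSpace ℝ (Fin d)) :
    gramOf B D = (LinearMap.toMatrix (EuclideanSpace.basisFun (Fin d) ℝ).toBasis
      (EuclideanSpace.basisFun (Fin d) ℝ).toBasis D)ᵀ * gramOf B LinearMap.id *
      LinearMap.toMatrix (EuclideanSpace.basisFun (Fin d) ℝ).toBasis
        (EuclideanSpace.basisFun (Fin d) ℝ).toBasis D := by
  have h : ∀ D : EuclideanSpace ℝ (Fin d) →ₗ[ℝ] EuclideanSpace ℝ (Fin d), gramOf B D =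
      LinearMap.BilinForm.toMatrix (EuclideanSpace.basisFun (Fin d) ℝ).toBasis (B.comp D D) := by
    intro D
    ext i j
    simp [gramOf, LinearMap.BilinForm.toMatrix_apply]
  rw [h, h, LinearMap.BilinForm.toMatrix_comp (EuclideanSpace.basisFun (Fin d) ℝ).toBasis
    (EuclideanSpace.basisFun (Fin d) ℝ).toBasis]
  rfl

/-- A change of frame multiplies the Gram determinant by the square of its determinant. -/
theorem det_gramOf_comp (B : LinearMap.BilinForm ℝ (EuclideanSpace ℝ (Fin d)))
    (D D' : EuclideanSpace ℝ (Fin d) →ₗ[ℝ] EuclideanSpace ℝ (Fin d)) :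
    (gramOf B (D ∘ₗ D')).det = LinearMap.det D' ^ 2 * (gramOf B D).det := by
  have h : gramOf B (D ∘ₗ D') = gramOf (B.comp D D) D' := rfl
  have h' : gramOf B D = gramOf (B.comp D D) LinearMap.id := rfl
  rw [h, h', gramOf_eq, Matrix.det_mul, Matrix.det_mul, Matrix.det_transpose,
    LinearMap.det_toMatrix]
  ring

/-- The pairing of two covectors by the inverse Gram matrix does not depend on the basis. -/
theorem dotProduct_gramOf_inv (B : LinearMap.BilinForm ℝ (EuclideanSpace ℝ (Fin d)))
    (α β : EuclideanSpace ℝ (Fin d) →ₗ[ℝ] ℝ)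
    (D : EuclideanSpace ℝ (Fin d) →ₗ[ℝ] EuclideanSpace ℝ (Fin d))
    (hD : Function.Bijective D) :
    (fun i => α (D (EuclideanSpace.single i 1))) ⬝ᵥ (gramOf B D)⁻¹ *ᵥ
        (fun i => β (D (EuclideanSpace.single i 1))) =
      (fun i => α (EuclideanSpace.single i 1)) ⬝ᵥ (gramOf B LinearMap.id)⁻¹ *ᵥ
        (fun i => β (EuclideanSpace.single i 1)) := by
  set b := (EuclideanSpace.basisFun (Fin d) ℝ).toBasis with hb
  set Q := LinearMap.toMatrix b b D with hQ
  have hcov : ∀ α : EuclideanSpace ℝ (Fin d) →ₗ[ℝ] ℝ,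
      (fun i => α (D (EuclideanSpace.single i 1))) =
        Qᵀ *ᵥ (fun i => α (EuclideanSpace.single i 1)) := fun α => by
    funext i
    have h1 : D (b i) = ∑ k, Q k i • b k := by
      conv_lhs => rw [← b.sum_repr (D (b i))]
      refine Finset.sum_congr rfl fun k _ => ?_
      rw [hQ, LinearMap.toMatrix_apply]
    have h2 : ∀ k, b k = EuclideanSpace.single k 1 := fun k => by simp [hb]
    rw [← h2, h1, map_sum]
    simp [Matrix.mulVec, dotProduct, h2]
  have hunit : IsUnit Q.det := by
    rw [hQ, LinearMap.det_toMatrix]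
    exact (LinearEquiv.ofBijective D hD).isUnit_det'
  have hunit' : IsUnit Qᵀ.det := by rwa [Matrix.det_transpose]
  rw [hcov α, hcov β, gramOf_eq, ← hb, ← hQ, Matrix.mul_inv_rev, Matrix.mul_inv_rev,
    Matrix.mulVec_mulVec, Matrix.dotProduct_mulVec, Matrix.vecMul_mulVec,
    ← Matrix.dotProduct_mulVec]
  congr 2
  rw [Matrix.transpose_transpose, Matrix.mul_assoc, Matrix.mul_assoc,
    Matrix.nonsing_inv_mul _ hunit', Matrix.mul_one, ← Matrix.mul_assoc,
    Matrix.mul_nonsing_inv _ hunit, Matrix.one_mul]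

end LinearAlgebra

section Metric

variable {d : ℕ} {M : Type*} [TopologicalSpace M] [ChartedSpace (EuclideanSpace ℝ (Fin d)) M]
  [IsManifold (𝓡 d) ∞ M]

/-- The metric at `x` as a bilinear form on the model space `ℝᵈ`, with which every tangent space is
identified. -/
def metricForm (g : Metric d M) (x : M) : LinearMap.BilinForm ℝ (EuclideanSpace ℝ (Fin d)) :=
  LinearMap.mk₂ ℝ (fun v w => g.inner x v w)
    (fun v v' w => congrArg (fun l => l w) ((g.inner x).map_add v v'))
    (fun c v w => congrArg (fun l => l w) ((g.inner x).map_smul c v))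
    (fun v w w' => (g.inner x v).map_add w w')
    (fun c v w => (g.inner x v).map_smul c w)

/-- The derivative at `y` of the inverse of a chart, as an endomorphism of the model space. -/
def chartFrame (e : OpenPartialHomeomorph M (EuclideanSpace ℝ (Fin d)))
    (y : EuclideanSpace ℝ (Fin d)) : EuclideanSpace ℝ (Fin d) →ₗ[ℝ] EuclideanSpace ℝ (Fin d) :=
  (mfderiv (𝓡 d) (𝓡 d) e.symm y).toLinearMap

/-- The differential of a function at `x` as a covector on the model space. -/
def differential (φ : M → ℝ) (x : M) : EuclideanSpace ℝ (Fin d) →ₗ[ℝ] ℝ :=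
  (mfderiv (𝓡 d) 𝓘(ℝ, ℝ) φ x).toLinearMap

/-- The matrix `g_ij` of the metric in the chart `e`, at the point with coordinates `y`. -/
def chartGram (g : Metric d M) (e : OpenPartialHomeomorph M (EuclideanSpace ℝ (Fin d)))
    (y : EuclideanSpace ℝ (Fin d)) : Matrix (Fin d) (Fin d) ℝ :=
  gramOf (metricForm g (e.symm y)) (chartFrame e y)

theorem posDef_gramMatrix (g : Metric d M) (x : M) : (gramMatrix g x).PosDef := by
  refine Matrix.PosDef.of_dotProduct_mulVec_pos ?_ fun v hv => ?_
  · ext i j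
    exact g.symm x _ _
  · have h2 : (WithLp.toLp 2 v : EuclideanSpace ℝ (Fin d)) =
        ∑ i, v i • EuclideanSpace.single i (1 : ℝ) := by
      ext j
      simp [Finset.sum_apply, Pi.single_apply]
    have h : 0 < metricForm g x (WithLp.toLp 2 v) (WithLp.toLp 2 v) :=
      g.pos x (WithLp.toLp 2 v : EuclideanSpace ℝ (Fin d)) fun h0 =>
        hv ((WithLp.toLp_eq_zero 2).1 h0)
    rw [h2] at h
    simp only [map_sum, map_smul, LinearMap.sum_apply, LinearMap.smul_apply, smul_eq_mul] at h
    refine lt_of_lt_of_eq h ?_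
    simp only [Finset.mul_sum]
    rw [star_trivial, dotProduct, Finset.sum_comm]
    refine Finset.sum_congr rfl fun i _ => ?_
    rw [Matrix.mulVec, dotProduct, Finset.mul_sum]
    refine Finset.sum_congr rfl fun j _ => ?_
    change v j * (v i * metricForm g x _ _) = v i * (metricForm g x _ _ * v j)
    ring

theorem gradInner_add_left (g : Metric d M) {φ χ : M → ℝ} (η : M → ℝ) (x : M)
    (hφ : MDifferentiableAt (𝓡 d) 𝓘(ℝ, ℝ) φ x) (hχ : MDifferentiableAt (𝓡 d) 𝓘(ℝ, ℝ) χ x) :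
    gradInner g (φ + χ) η x = gradInner g φ η x + gradInner g χ η x := by
  have : partials (d := d) (φ + χ) x = partials φ x + partials χ x := by
    funext i
    simp only [partials, Pi.add_apply]
    rw [mfderiv_add hφ hχ]
    rfl
  rw [gradInner, this, add_dotProduct]
  rfl

theorem gradInner_smul_left (g : Metric d M) {φ : M → ℝ} (c : ℝ) (η : M → ℝ) (x : M)
    (hφ : MDifferentiableAt (𝓡 d) 𝓘(ℝ, ℝ) φ x) :
    gradInner g (c • φ) η x = c * gradInner g φ η x := by
  have : partials (d := d) (c • φ) x = c • partials φ x := by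
    funext i
    simp only [partials, Pi.smul_apply]
    rw [const_smul_mfderiv hφ]
    rfl
  rw [gradInner, this, smul_dotProduct]
  rfl

theorem gradInner_comm (g : Metric d M) (φ χ : M → ℝ) (x : M) :
    gradInner g φ χ x = gradInner g χ φ x := by
  have hs : ((gramMatrix g x)⁻¹)ᵀ = (gramMatrix g x)⁻¹ := by
    have := (posDef_gramMatrix g x).inv.isHermitian
    rwa [Matrix.IsHermitian, Matrix.conjTranspose_eq_transpose_of_trivial] at this
  rw [gradInner, gradInner, Matrix.dotProduct_mulVec, ← Matrix.mulVec_transpose, hs, dotProduct_comm]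

theorem gradInner_self_nonneg (g : Metric d M) (φ : M → ℝ) (x : M) : 0 ≤ gradInner g φ φ x := by
  have := (posDef_gramMatrix g x).inv.posSemidef.dotProduct_mulVec_nonneg (partials φ x)
  simpa [gradInner] using this

/-- Coordinate expression `g^{ij} ∂_i φ ∂_j χ` of the pairing of gradients in any frame. -/
theorem gradInner_eq_of_frame (g : Metric d M) (φ χ : M → ℝ) (x : M)
    (D : EuclideanSpace ℝ (Fin d) →ₗ[ℝ] EuclideanSpace ℝ (Fin d)) (hD : Function.Bijective D) :
    gradInner g φ χ x =
      (fun i => differential φ x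
        (D (EuclideanSpace.single i 1))) ⬝ᵥ (gramOf (metricForm g x) D)⁻¹ *ᵥ
      (fun i => differential χ x
        (D (EuclideanSpace.single i 1))) :=
  (dotProduct_gramOf_inv (metricForm g x)
    (differential φ x)
    (differential χ x) D hD).symm

/-- Isometries preserve the pairing of gradients. -/
theorem gradInner_comp_symm {g : Metric d M} {ψ : Diffeomorph (𝓡 d) (𝓡 d) M M ∞}
    (hψ : IsIsometry g ψ) {φ χ : M → ℝ} (hφ : MDifferentiable (𝓡 d) 𝓘(ℝ, ℝ) φ)
    (hχ : MDifferentiable (𝓡 d) 𝓘(ℝ, ℝ) χ) (x : M) :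
    gradInner g (φ ∘ ψ.symm) (χ ∘ ψ.symm) (ψ x) = gradInner g φ χ x := by
  let D : EuclideanSpace ℝ (Fin d) →L[ℝ] EuclideanSpace ℝ (Fin d) := mfderiv (𝓡 d) (𝓡 d) ψ x
  have hD : Function.Bijective D := by
    have := (ψ.mfderivToContinuousLinearEquiv (by simp) x).bijective
    exact this
  have hψd : MDifferentiableAt (𝓡 d) (𝓡 d) ψ x := ψ.contMDiff.mdifferentiableAt (by simp)
  have hψsd : MDifferentiable (𝓡 d) (𝓡 d) ψ.symm := ψ.symm.contMDiff.mdifferentiable (by simp)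
  have hpart : ∀ {φ : M → ℝ}, MDifferentiable (𝓡 d) 𝓘(ℝ, ℝ) φ → ∀ v,
      differential (φ ∘ ψ.symm) (ψ x) (D v) =
        differential φ x v := fun {φ} hφ v => by
    have h1 := mfderiv_comp x ((hφ.comp hψsd) (ψ x)) hψd
    have h2 : (φ ∘ ψ.symm) ∘ ψ = φ := by
      funext z; simp
    rw [h2] at h1
    exact congrArg (fun l => l v) h1.symm
  rw [gradInner_eq_of_frame g _ _ (ψ x) D.toLinearMap hD]
  have hgram : gramOf (metricForm g (ψ x)) D.toLinearMap = gramMatrix g x := by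
    ext i j
    exact hψ x (EuclideanSpace.single i (1 : ℝ) : EuclideanSpace ℝ (Fin d))
      (EuclideanSpace.single j (1 : ℝ) : EuclideanSpace ℝ (Fin d))
  rw [hgram]
  have hfun : ∀ {φ : M → ℝ}, MDifferentiable (𝓡 d) 𝓘(ℝ, ℝ) φ →
      (fun i => differential (φ ∘ ψ.symm) (ψ x) (D.toLinearMap (EuclideanSpace.single i 1))) =
        partials φ x := fun hφ => funext fun i => hpart hφ _
  rw [hfun hφ, hfun hχ]
  rfl

theorem mdifferentiable_chartAt (x₀ : M) :
    (chartAt (EuclideanSpace ℝ (Fin d)) x₀).MDifferentiable (𝓡 d) (𝓡 d) := by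
  have : IsManifold (𝓡 d) 1 M := IsManifold.of_le (n := ∞) (by simp)
  exact mdifferentiable_chart x₀

theorem isIsometry_symm {g : Metric d M} {ψ : Diffeomorph (𝓡 d) (𝓡 d) M M ∞}
    (hψ : IsIsometry g ψ) : IsIsometry g ψ.symm := by
  intro x v w
  have hcomp := mfderiv_comp x
    (ψ.contMDiff.mdifferentiableAt (by simp) : MDifferentiableAt (𝓡 d) (𝓡 d) ψ (ψ.symm x))
    (ψ.symm.contMDiff.mdifferentiableAt (by simp) : MDifferentiableAt (𝓡 d) (𝓡 d) ψ.symm x)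
  have hid : ψ ∘ ψ.symm = id := funext fun z => ψ.apply_symm_apply z
  rw [hid, mfderiv_id] at hcomp
  have hv : ∀ u : TangentSpace (𝓡 d) x, mfderiv (𝓡 d) (𝓡 d) ψ (ψ.symm x)
      (mfderiv (𝓡 d) (𝓡 d) ψ.symm x u) = (u : EuclideanSpace ℝ (Fin d)) := fun u =>
    (congrArg (fun l => l u) hcomp).symm
  rw [← hψ (ψ.symm x), hv, hv]
  have : ∀ z, z = x → metricForm g z v w = metricForm g x v w := fun z hz => by rw [hz]
  exact this _ (ψ.apply_symm_apply x)

end Metric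

/-! ### The Riemannian volume -/

theorem measurableSet_target_inter_preimage {d : ℕ} {M : Type*} [TopologicalSpace M]
    [MeasurableSpace M] [BorelSpace M]
    (e : OpenPartialHomeomorph M (EuclideanSpace ℝ (Fin d))) {s : Set M} (hs : MeasurableSet s) :
    MeasurableSet (e.target ∩ e.symm ⁻¹' s) := by
  have h := e.open_target.measurableSet.subtype_image
    ((continuousOn_iff_continuous_domRestrict.1 e.continuousOn_symm).measurable hs)
  convert h using 1
  ext y
  simp [Set.mem_image, and_comm]

section Volume

variable {d : ℕ} {M : Type*} [TopologicalSpace M] [ChartedSpace (EuclideanSpace ℝ (Fin d)) M]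
  [IsManifold (𝓡 d) ∞ M] [MeasurableSpace M]

/-- The measure `√(det g_ij) dx` on the domain of an arbitrary chart `e`. -/
def paramVolume (g : Metric d M) (e : OpenPartialHomeomorph M (EuclideanSpace ℝ (Fin d))) :
    Measure M :=
  (((volume : Measure (EuclideanSpace ℝ (Fin d))).restrict e.target).withDensity
    fun y => ENNReal.ofReal √(chartGram g e y).det).map e.symm

theorem chartVolume_eq_paramVolume (g : Metric d M) (x₀ : M) :
    chartVolume g x₀ = paramVolume g (chartAt (EuclideanSpace ℝ (Fin d)) x₀) := rfl

variable [BorelSpace M]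

theorem paramVolume_apply (g : Metric d M)
    (e : OpenPartialHomeomorph M (EuclideanSpace ℝ (Fin d))) {s : Set M} (hs : MeasurableSet s) :
    paramVolume g e s =
      ∫⁻ y in e.target ∩ e.symm ⁻¹' s, ENNReal.ofReal √(chartGram g e y).det := by
  have hT := e.open_target.measurableSet
  have hae : AEMeasurable e.symm ((volume : Measure (EuclideanSpace ℝ (Fin d))).restrict e.target) :=
    e.continuousOn_symm.aemeasurable hT
  rw [paramVolume, Measure.map_apply_of_aemeasurable
    (hae.mono_ac (withDensity_absolutelyContinuous _ _)) hs, ← restrict_withDensity hT,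
    Measure.restrict_apply' hT, Set.inter_comm,
    withDensity_apply _ (measurableSet_target_inter_preimage e hs)]

theorem paramVolume_restrict_source (g : Metric d M)
    (e : OpenPartialHomeomorph M (EuclideanSpace ℝ (Fin d))) :
    (paramVolume g e).restrict e.source = paramVolume g e := by
  ext s hs
  rw [Measure.restrict_apply hs, paramVolume_apply g e (hs.inter e.open_source.measurableSet),
    paramVolume_apply g e hs]
  congr 2
  ext y
  simp only [Set.mem_inter_iff, Set.mem_preimage]
  exact ⟨fun h => ⟨h.1, h.2.1⟩, fun h => ⟨h.1, h.2, e.map_target h.1⟩⟩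

/-- Two charts define the same measure on the intersection of their domains. -/
theorem paramVolume_apply_eq (g : Metric d M)
    {e e' : OpenPartialHomeomorph M (EuclideanSpace ℝ (Fin d))}
    (he : e.MDifferentiable (𝓡 d) (𝓡 d)) (he' : e'.MDifferentiable (𝓡 d) (𝓡 d)) {s : Set M}
    (hs : MeasurableSet s) (hse : s ⊆ e.source) (hse' : s ⊆ e'.source) :
    paramVolume g e s = paramVolume g e' s := by
  set τ : EuclideanSpace ℝ (Fin d) → EuclideanSpace ℝ (Fin d) := e' ∘ e.symm with hτ
  have himage : e'.target ∩ e'.symm ⁻¹' s = τ '' (e.target ∩ e.symm ⁻¹' s) := by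
    ext z
    constructor
    · rintro ⟨hz, hzs⟩
      refine ⟨e (e'.symm z), ⟨e.map_source (hse hzs), ?_⟩, ?_⟩
      · simpa [e.left_inv (hse hzs)] using hzs
      · simp [hτ, e.left_inv (hse hzs), e'.right_inv hz]
    · rintro ⟨y, ⟨hy, hys⟩, rfl⟩
      refine ⟨e'.map_source (hse' hys), ?_⟩
      simpa [hτ, e'.left_inv (hse' hys)] using hys
  have hinj : Set.InjOn τ (e.target ∩ e.symm ⁻¹' s) := by
    intro y hy z hz hyz
    exact e.symm.injOn hy.1 hz.1 (e'.injOn (hse' hy.2) (hse' hz.2) hyz)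
  have hmd : ∀ y ∈ e.target ∩ e.symm ⁻¹' s, MDifferentiableAt (𝓡 d) (𝓡 d) τ y := fun y hy =>
    (he'.mdifferentiableAt (hse' hy.2)).comp y (he.mdifferentiableAt_symm hy.1)
  have hfd : ∀ y ∈ e.target ∩ e.symm ⁻¹' s,
      HasFDerivWithinAt τ (fderiv ℝ τ y) (e.target ∩ e.symm ⁻¹' s) y := fun y hy =>
    (mdifferentiableAt_iff_differentiableAt.1 (hmd y hy)).hasFDerivAt.hasFDerivWithinAt
  rw [paramVolume_apply g e hs, paramVolume_apply g e' hs, himage,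
    lintegral_image_eq_lintegral_abs_det_fderiv_mul volume
      (measurableSet_target_inter_preimage e hs) hfd hinj]
  refine setLIntegral_congr_fun (measurableSet_target_inter_preimage e hs) fun y hy => ?_
  have hpoint : e'.symm (τ y) = e.symm y := e'.left_inv (hse' hy.2)
  have hframe : chartFrame e y = chartFrame e' (τ y) ∘ₗ (fderiv ℝ τ y).toLinearMap := by
    have hev : e'.symm ∘ τ =ᶠ[𝓝 y] e.symm := by
      have hopen : e.target ∩ e.symm ⁻¹' e'.source ∈ 𝓝 y :=
        (e.symm.isOpen_inter_preimage e'.open_source).mem_nhds ⟨hy.1, hse' hy.2⟩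
      filter_upwards [hopen] with z hz
      exact e'.left_inv hz.2
    have hcomp := mfderiv_comp y
      (he'.mdifferentiableAt_symm (e'.map_source (hse' hy.2))) (hmd y hy)
    have hcongr := hev.mfderiv_eq (I := 𝓡 d) (I' := 𝓡 d)
    have hfder : mfderiv (𝓡 d) (𝓡 d) τ y = fderiv ℝ τ y := mfderiv_eq_fderiv
    ext v : 1
    have h1 : chartFrame e y v = (mfderiv (𝓡 d) (𝓡 d) (e'.symm ∘ τ) y) v :=
      congrArg (fun l => l v) hcongr.symm
    have h2 : (mfderiv (𝓡 d) (𝓡 d) (e'.symm ∘ τ) y) v =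
        chartFrame e' (τ y) (mfderiv (𝓡 d) (𝓡 d) τ y v) := congrArg (fun l => l v) hcomp
    rw [h1, h2, hfder]
    rfl
  have hdet : (chartGram g e y).det =
      LinearMap.det (fderiv ℝ τ y).toLinearMap ^ 2 * (chartGram g e' (τ y)).det := by
    rw [chartGram, chartGram, hpoint, hframe, det_gramOf_comp]
  rw [hdet, Real.sqrt_mul (sq_nonneg _), Real.sqrt_sq_eq_abs, ENNReal.ofReal_mul (abs_nonneg _)]

theorem paramVolume_restrict_eq (g : Metric d M)
    {e e' : OpenPartialHomeomorph M (EuclideanSpace ℝ (Fin d))}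
    (he : e.MDifferentiable (𝓡 d) (𝓡 d)) (he' : e'.MDifferentiable (𝓡 d) (𝓡 d)) :
    (paramVolume g e).restrict (e.source ∩ e'.source) =
      (paramVolume g e').restrict (e.source ∩ e'.source) := by
  have hm := (e.open_source.inter e'.open_source).measurableSet
  ext s hs
  rw [Measure.restrict_apply hs, Measure.restrict_apply hs]
  exact paramVolume_apply_eq g he he' (hs.inter hm) (fun x hx => hx.2.1) (fun x hx => hx.2.2)

/-- On the domain of `chartAt x₀`, the supremum that defines the volume is attained by the measure
of that chart. -/
theorem vol_restrict_chartAt (g : Metric d M) (x₀ : M) :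
    (vol g).restrict (chartAt (EuclideanSpace ℝ (Fin d)) x₀).source = chartVolume g x₀ := by
  set U := (chartAt (EuclideanSpace ℝ (Fin d)) x₀).source with hU
  have hUm : MeasurableSet U :=
    (chartAt (EuclideanSpace ℝ (Fin d)) x₀).open_source.measurableSet
  refine le_antisymm ?_ ?_
  · -- A measure that is infinite off `U` dominates every `chartVolume g x₁` there, and on `U` all of
    -- these are at most `chartVolume g x₀`; so the uncountable supremum is dominated as well.
    have hle : vol g ≤ chartVolume g x₀ + (⊤ : Measure M).restrict Uᶜ := by
      refine iSup_le fun x₁ => ?_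
      rw [← Measure.restrict_add_restrict_compl (μ := chartVolume g x₁) hUm]
      refine add_le_add ?_ (Measure.restrict_mono le_rfl le_top)
      have h := paramVolume_restrict_eq g (mdifferentiable_chartAt x₀) (mdifferentiable_chartAt x₁)
      rw [chartVolume_eq_paramVolume, ← paramVolume_restrict_source,
        Measure.restrict_restrict hUm, hU, ← h]
      exact Measure.restrict_le_self
    calc (vol g).restrict U ≤ (chartVolume g x₀ + (⊤ : Measure M).restrict Uᶜ).restrict U :=
          Measure.restrict_mono le_rfl hle
      _ = (chartVolume g x₀).restrict U := by
          rw [Measure.restrict_add, Measure.restrict_restrict hUm, Set.inter_compl_self,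
            Measure.restrict_empty, add_zero]
      _ ≤ chartVolume g x₀ := Measure.restrict_le_self
  · conv_lhs => rw [chartVolume_eq_paramVolume, ← paramVolume_restrict_source]
    exact Measure.restrict_mono le_rfl (le_iSup (chartVolume g) x₀)

/-- The volume is computed by every differentiable chart, not only by the preferred ones. -/
theorem vol_restrict_source (g : Metric d M)
    {e : OpenPartialHomeomorph M (EuclideanSpace ℝ (Fin d))}
    (he : e.MDifferentiable (𝓡 d) (𝓡 d)) : (vol g).restrict e.source = paramVolume g e := by
  -- `e.source` is covered by the domains of countably many preferred charts, even if `M` is not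
  -- assumed to be second countable.
  have hL : IsLindelof e.source := by
    rw [← e.symm_image_target_eq_source]
    exact (HereditarilyLindelofSpace.isLindelof e.target).image_of_continuousOn
      e.continuousOn_symm
  obtain ⟨t, ht, hcov⟩ := hL.elim_countable_subcover
    (fun x : M => (chartAt (EuclideanSpace ℝ (Fin d)) x).source)
    (fun x => (chartAt (EuclideanSpace ℝ (Fin d)) x).open_source)
    (fun x _ => Set.mem_iUnion.2 ⟨x, mem_chart_source _ x⟩)
  have hset : e.source = ⋃ x ∈ t, e.source ∩ (chartAt (EuclideanSpace ℝ (Fin d)) x).source := by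
    rw [← Set.inter_iUnion₂]
    exact (Set.inter_eq_left.2 hcov).symm
  rw [← paramVolume_restrict_source g e, hset, Measure.restrict_biUnion_congr ht]
  intro x _
  have hUm : MeasurableSet e.source := e.open_source.measurableSet
  rw [paramVolume_restrict_eq g he (mdifferentiable_chartAt x), ← chartVolume_eq_paramVolume,
    ← vol_restrict_chartAt, Measure.restrict_restrict (hUm.inter
      (chartAt (EuclideanSpace ℝ (Fin d)) x).open_source.measurableSet),
    Set.inter_assoc, Set.inter_self]

/-- An isometry carries the measure of a chart to the measure of the transported chart. -/
theorem map_paramVolume {g : Metric d M} {ψ : Diffeomorph (𝓡 d) (𝓡 d) M M ∞}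
    (hψ : IsIsometry g ψ) {e : OpenPartialHomeomorph M (EuclideanSpace ℝ (Fin d))}
    (he : e.MDifferentiable (𝓡 d) (𝓡 d)) :
    (paramVolume g e).map ψ =
      paramVolume g (ψ.symm.toHomeomorph.toOpenPartialHomeomorph.trans e) := by
  have htarget : (ψ.symm.toHomeomorph.toOpenPartialHomeomorph.trans e).target = e.target := by
    simp
  have hsymm : ⇑(ψ.symm.toHomeomorph.toOpenPartialHomeomorph.trans e).symm = ψ ∘ e.symm := rfl
  ext s hs
  have hsψ : MeasurableSet (ψ ⁻¹' s) := ψ.continuous.measurable hs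
  rw [Measure.map_apply ψ.continuous.measurable hs, paramVolume_apply g _ hs,
    paramVolume_apply g e hsψ, htarget, hsymm]
  refine setLIntegral_congr_fun (measurableSet_target_inter_preimage e hsψ) fun y hy => ?_
  have hgram : chartGram g (ψ.symm.toHomeomorph.toOpenPartialHomeomorph.trans e) y =
      chartGram g e y := by
    have hcomp := mfderiv_comp y
      (ψ.contMDiff.mdifferentiableAt (by simp) : MDifferentiableAt (𝓡 d) (𝓡 d) ψ (e.symm y))
      (he.mdifferentiableAt_symm hy.1)
    have hv : ∀ v, chartFrame (ψ.symm.toHomeomorph.toOpenPartialHomeomorph.trans e) y v =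
        mfderiv (𝓡 d) (𝓡 d) ψ (e.symm y) (chartFrame e y v) := fun v =>
      congrArg (fun l => l v) hcomp
    ext i j
    rw [chartGram, gramOf, Matrix.of_apply, hv, hv]
    exact hψ (e.symm y) _ _
  simp only [hgram]

theorem map_vol_le {g : Metric d M} {ψ : Diffeomorph (𝓡 d) (𝓡 d) M M ∞} (hψ : IsIsometry g ψ)
    (x₀ : M) : (chartVolume g x₀).map ψ ≤ vol g := by
  rw [chartVolume_eq_paramVolume, map_paramVolume hψ (mdifferentiable_chartAt x₀),
    ← vol_restrict_source]
  · exact Measure.restrict_le_self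
  · have h : (ψ.symm.toHomeomorph.toOpenPartialHomeomorph).MDifferentiable (𝓡 d) (𝓡 d) :=
      ψ.symm.toOpenPartialHomeomorph_mdifferentiable (by simp)
    exact h.trans (mdifferentiable_chartAt x₀)

theorem vol_le_map_vol {g : Metric d M} {ψ : Diffeomorph (𝓡 d) (𝓡 d) M M ∞}
    (hψ : IsIsometry g ψ) : vol g ≤ (vol g).map ψ := by
  refine iSup_le fun x₀ => ?_
  have h := Measure.map_mono (map_vol_le (isIsometry_symm hψ) x₀) ψ.continuous.measurable
  rw [Measure.map_map ψ.continuous.measurable ψ.symm.continuous.measurable] at h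
  have hid : ψ ∘ ψ.symm = id := funext fun z => ψ.apply_symm_apply z
  rwa [hid, Measure.map_id] at h

/-- Isometries preserve the Riemannian volume. -/
theorem measurePreserving_of_isIsometry {g : Metric d M} {ψ : Diffeomorph (𝓡 d) (𝓡 d) M M ∞}
    (hψ : IsIsometry g ψ) : MeasurePreserving ψ (vol g) (vol g) := by
  refine ⟨ψ.continuous.measurable, le_antisymm ?_ (vol_le_map_vol hψ)⟩
  have h := Measure.map_mono (vol_le_map_vol (isIsometry_symm hψ)) ψ.continuous.measurable
  rw [Measure.map_map ψ.continuous.measurable ψ.symm.continuous.measurable] at h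
  have hid : ψ ∘ ψ.symm = id := funext fun z => ψ.apply_symm_apply z
  rwa [hid, Measure.map_id] at h

end Volume

/-! ### Continuity of the metric and of gradient pairings -/

section Continuity

variable {d : ℕ} {M : Type*} [TopologicalSpace M] [ChartedSpace (EuclideanSpace ℝ (Fin d)) M]
  [IsManifold (𝓡 d) ∞ M]

/-- The coefficients `g_ij` are continuous: the coordinate vector fields are continuous sections of
the tangent bundle, as images of constant sections under the tangent map of the inverse chart. -/
theorem continuousOn_chartGram (g : Metric d M) (x₀ : M) :
    ContinuousOn (chartGram g (chartAt (EuclideanSpace ℝ (Fin d)) x₀))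
      (chartAt (EuclideanSpace ℝ (Fin d)) x₀).target := by
  set e := chartAt (EuclideanSpace ℝ (Fin d)) x₀ with he
  have hman : IsManifold (𝓡 d) 1 M := IsManifold.of_le (n := ∞) (by simp)
  have hsymm : ContMDiffOn (𝓡 d) (𝓡 d) 1 e.symm e.target := contMDiffOn_chart_symm
  have huniq : UniqueMDiffOn (𝓡 d) e.target := e.open_target.uniqueMDiffOn
  have hvec : ∀ v : EuclideanSpace ℝ (Fin d), ContMDiffOn (𝓡 d) ((𝓡 d).prod (𝓡 d)) 0
      (fun y => (⟨e.symm y, chartFrame e y v⟩ : TangentBundle (𝓡 d) M)) e.target := fun v => by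
    have h1 := hsymm.contMDiffOn_tangentMapWithin (m := 0) (by simp) huniq
    have h2 : ContMDiff (𝓡 d) ((𝓡 d).prod (𝓡 d)) 0
        (fun y => (⟨y, v⟩ : TangentBundle (𝓡 d) (EuclideanSpace ℝ (Fin d)))) :=
      contMDiff_vectorSpace_iff_contDiff.2 contDiff_const
    refine (h1.comp h2.contMDiffOn (s := e.target) fun y hy => hy).congr fun y hy => ?_
    simp only [Function.comp_apply, tangentMapWithin]
    rw [mfderivWithin_of_isOpen e.open_target hy]
    rfl
  have hg : ContMDiffOn (𝓡 d) ((𝓡 d).prod 𝓘(ℝ, EuclideanSpace ℝ (Fin d) →L[ℝ]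
      EuclideanSpace ℝ (Fin d) →L[ℝ] ℝ)) 0
      (fun y => Bundle.TotalSpace.mk' (EuclideanSpace ℝ (Fin d) →L[ℝ]
        EuclideanSpace ℝ (Fin d) →L[ℝ] ℝ)
        (E := fun x : M => TangentSpace (𝓡 d) x →L[ℝ] TangentSpace (𝓡 d) x →L[ℝ] ℝ)
        (e.symm y) (g.inner (e.symm y))) e.target :=
    (g.contMDiff.of_le (by simp)).comp_contMDiffOn (hsymm.of_le (by simp))
  have hentry : ∀ i j, ContinuousOn (fun y => chartGram g e y i j) e.target := fun i j => by
    have h := ContMDiffOn.clm_bundle_apply₂ (E₃ := Bundle.Trivial M ℝ) (F₃ := ℝ) hg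
      (hvec (EuclideanSpace.single i 1)) (hvec (EuclideanSpace.single j 1))
    intro y hy
    have hy' := h y hy
    rw [Bundle.contMDiffWithinAt_totalSpace] at hy'
    exact hy'.2.continuousWithinAt
  exact continuousOn_pi.2 fun i => continuousOn_pi.2 fun j => hentry i j

theorem chartFrame_bijective (x₀ : M) {y : EuclideanSpace ℝ (Fin d)}
    (hy : y ∈ (chartAt (EuclideanSpace ℝ (Fin d)) x₀).target) :
    Function.Bijective (chartFrame (chartAt (EuclideanSpace ℝ (Fin d)) x₀) y) :=
  (mdifferentiable_chartAt x₀).symm.mfderiv_bijective hy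

theorem det_chartGram_ne_zero (g : Metric d M) (x₀ : M) {y : EuclideanSpace ℝ (Fin d)}
    (hy : y ∈ (chartAt (EuclideanSpace ℝ (Fin d)) x₀).target) :
    (chartGram g (chartAt (EuclideanSpace ℝ (Fin d)) x₀) y).det ≠ 0 := by
  have h := det_gramOf_comp (metricForm g ((chartAt (EuclideanSpace ℝ (Fin d)) x₀).symm y))
    LinearMap.id (chartFrame (chartAt (EuclideanSpace ℝ (Fin d)) x₀) y)
  rw [LinearMap.id_comp] at h
  rw [chartGram, h]
  refine mul_ne_zero (pow_ne_zero _ ?_) ?_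
  · exact (LinearEquiv.ofBijective _ (chartFrame_bijective x₀ hy)).isUnit_det'.ne_zero
  · exact (posDef_gramMatrix g _).det_pos.ne'

/-- The pairing of gradients of smooth functions is continuous: in a chart it is
`g^{ij} ∂_i φ ∂_j χ`. -/
theorem continuous_gradInner (g : Metric d M) {φ χ : M → ℝ} (hφ : ContMDiff (𝓡 d) 𝓘(ℝ, ℝ) ∞ φ)
    (hχ : ContMDiff (𝓡 d) 𝓘(ℝ, ℝ) ∞ χ) : Continuous (gradInner g φ χ) := by
  rw [continuous_iff_continuousAt]
  intro x₀
  set e := chartAt (EuclideanSpace ℝ (Fin d)) x₀ with he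
  have hx₀ : x₀ ∈ e.source := mem_chart_source _ x₀
  have hmd := mdifferentiable_chartAt (d := d) x₀
  rw [← he] at hmd
  have hpart : ∀ {φ : M → ℝ}, ContMDiff (𝓡 d) 𝓘(ℝ, ℝ) ∞ φ →
      ContinuousOn (fun y i => differential φ (e.symm y)
        (chartFrame e y (EuclideanSpace.single i 1))) e.target := fun {φ} hφ => by
    have hcd : ContDiffOn ℝ ∞ (φ ∘ e.symm) e.target :=
      contMDiffOn_iff_contDiffOn.1 (hφ.comp_contMDiffOn contMDiffOn_chart_symm)
    have hcont := hcd.continuousOn_fderiv_of_isOpen e.open_target (by simp)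
    refine continuousOn_pi.2 fun i => (hcont.clm_apply
      (continuousOn_const (c := EuclideanSpace.single i (1 : ℝ)))).congr fun y hy => ?_
    have hcomp := mfderiv_comp y
      (hφ.mdifferentiableAt (by simp) : MDifferentiableAt (𝓡 d) 𝓘(ℝ, ℝ) φ (e.symm y))
      (hmd.mdifferentiableAt_symm hy)
    rw [mfderiv_eq_fderiv] at hcomp
    exact congrArg (fun l => l (EuclideanSpace.single i (1 : ℝ) : EuclideanSpace ℝ (Fin d)))
      hcomp.symm
  have hgram := continuousOn_chartGram g x₀
  rw [← he] at hgram
  have hinv : ContinuousOn (fun y => (chartGram g e y)⁻¹) e.target := by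
    simp only [Matrix.inv_def, Ring.inverse_eq_inv']
    refine ContinuousOn.smul (ContinuousOn.inv₀ ?_ fun y hy => det_chartGram_ne_zero g x₀ hy) ?_
    · exact (continuous_id.matrix_det).comp_continuousOn hgram
    · exact (continuous_id.matrix_adjugate).comp_continuousOn hgram
  have hF : ContinuousOn (fun y => (fun i => differential φ (e.symm y)
      (chartFrame e y (EuclideanSpace.single i 1))) ⬝ᵥ (chartGram g e y)⁻¹ *ᵥ
        (fun i => differential χ (e.symm y) (chartFrame e y (EuclideanSpace.single i 1))))
      e.target := by
    have hcont : Continuous fun p : (Fin d → ℝ) × Matrix (Fin d) (Fin d) ℝ × (Fin d → ℝ) =>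
        p.1 ⬝ᵥ p.2.1 *ᵥ p.2.2 :=
      continuous_fst.dotProduct (continuous_snd.fst.matrix_mulVec continuous_snd.snd)
    exact hcont.comp_continuousOn ((hpart hφ).prodMk (hinv.prodMk (hpart hχ)))
  have hcomp := (hF.continuousAt (e.open_target.mem_nhds (e.map_source hx₀))).comp
    (e.continuousAt hx₀)
  refine hcomp.congr ?_
  filter_upwards [e.open_source.mem_nhds hx₀] with x hx
  have hxe : e.symm (e x) = x := e.left_inv hx
  rw [gradInner_eq_of_frame g φ χ x (chartFrame e (e x))
    (chartFrame_bijective x₀ (e.map_source hx))]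
  simp only [Function.comp_apply, chartGram, hxe]

theorem gradInner_eq_zero (g : Metric d M) {φ : M → ℝ} (χ : M → ℝ) {x : M} (hx : x ∉ tsupport φ) :
    gradInner g φ χ x = 0 := by
  have h : φ =ᶠ[𝓝 x] fun _ => 0 := notMem_tsupport_iff_eventuallyEq.1 hx
  have hp : partials (d := d) φ x = 0 := by
    funext i
    have h1 : mfderiv (𝓡 d) 𝓘(ℝ, ℝ) φ x = mfderiv (𝓡 d) 𝓘(ℝ, ℝ) (fun _ => (0 : ℝ)) x :=
      h.mfderiv_eq
    rw [mfderiv_const] at h1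
    exact congrArg (fun l => l (EuclideanSpace.single i (1 : ℝ) : EuclideanSpace ℝ (Fin d))) h1
  rw [gradInner, hp, zero_dotProduct]

variable [MeasurableSpace M] [BorelSpace M]

/-- The Riemannian volume is locally finite, since near `x` it has a continuous density in the
chart at `x`. -/
theorem isLocallyFiniteMeasure_vol (g : Metric d M) : IsLocallyFiniteMeasure (vol g) := by
  refine ⟨fun x => ?_⟩
  set e := chartAt (EuclideanSpace ℝ (Fin d)) x with he
  have hx : x ∈ e.source := mem_chart_source _ x
  obtain ⟨r, hr, hball⟩ := Metric.nhds_basis_closedBall.mem_iff.1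
    (e.open_target.mem_nhds (e.map_source hx))
  have hU : e.source ∩ e ⁻¹' Metric.ball (e x) r ∈ 𝓝 x :=
    (e.isOpen_inter_preimage Metric.isOpen_ball).mem_nhds ⟨hx, Metric.mem_ball_self hr⟩
  refine ⟨_, hU, ?_⟩
  have hUm : MeasurableSet (e.source ∩ e ⁻¹' Metric.ball (e x) r) :=
    (e.isOpen_inter_preimage Metric.isOpen_ball).measurableSet
  have h1 : vol g (e.source ∩ e ⁻¹' Metric.ball (e x) r) =
      paramVolume g e (e.source ∩ e ⁻¹' Metric.ball (e x) r) := by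
    rw [he, ← chartVolume_eq_paramVolume, ← vol_restrict_chartAt, ← he,
      Measure.restrict_apply hUm, Set.inter_right_comm, Set.inter_self]
  rw [h1, paramVolume_apply g e hUm]
  have hsub : e.target ∩ e.symm ⁻¹' (e.source ∩ e ⁻¹' Metric.ball (e x) r) ⊆
      Metric.closedBall (e x) r := fun y hy => by
    have h2 := hy.2.2
    rw [Set.mem_preimage, e.right_inv hy.1] at h2
    exact Metric.ball_subset_closedBall h2
  refine (lintegral_mono_set hsub).trans_lt ?_
  have hcont : ContinuousOn (fun y => √(chartGram g e y).det) (Metric.closedBall (e x) r) :=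
    (((continuous_id.matrix_det).comp_continuousOn (continuousOn_chartGram g x)).sqrt).mono hball
  exact (hcont.integrableOn_compact (isCompact_closedBall _ _)).lintegral_lt_top

theorem integrable_gradInner (g : Metric d M) (φ χ : TestFunctions d M) :
    Integrable (gradInner g φ χ) (vol g) := by
  have := isLocallyFiniteMeasure_vol g
  refine (continuous_gradInner g φ.2.1 χ.2.1).integrable_of_hasCompactSupport ?_
  refine φ.2.2.mono' fun x hx => ?_
  by_contra h
  exact hx (gradInner_eq_zero g _ h)

theorem memLp_testFunction (g : Metric d M) (φ : TestFunctions d M) :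
    MemLp (φ : M → ℝ) 2 (vol g) := by
  have := isLocallyFiniteMeasure_vol g
  exact φ.2.1.continuous.memLp_of_hasCompactSupport φ.2.2

end Continuity

/-! ### The free covariance as a bounded operator -/

section Covariance

variable {d : ℕ} {M : Type*} [TopologicalSpace M]
  [ChartedSpace (EuclideanSpace ℝ (Fin d)) M] [IsManifold (𝓡 d) ∞ M] [MeasurableSpace M]

theorem dirichletForm_self_nonneg (g : Metric d M) (φ : M → ℝ) : 0 ≤ dirichletForm g φ φ :=
  integral_nonneg fun x => gradInner_self_nonneg g φ x

variable [BorelSpace M]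

/-- The inclusion of the test functions into `L²(M)`. -/
def toL2 (g : Metric d M) : TestFunctions d M →ₗ[ℝ] Lp ℝ 2 (vol g) where
  toFun φ := (memLp_testFunction g φ).toLp (φ : M → ℝ)
  map_add' _ _ := rfl
  map_smul' _ _ := rfl

theorem coeFn_toL2 (g : Metric d M) (φ : TestFunctions d M) : toL2 g φ =ᵐ[vol g] (φ : M → ℝ) :=
  (memLp_testFunction g φ).coeFn_toLp

theorem inner_toL2 (g : Metric d M) (u : Lp ℝ 2 (vol g)) (χ : TestFunctions d M) :
    inner ℝ u (toL2 g χ) = ∫ x, u x * χ.1 x ∂(vol g) := by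
  rw [L2.inner_def]
  refine integral_congr_ae ?_
  filter_upwards [coeFn_toL2 g χ] with x hx
  rw [hx, RCLike.inner_apply]
  simp [mul_comm]

/-- The form `∫ ⟨∇φ, ∇χ⟩ dvol + m² ∫ φ χ dvol` on test functions. -/
def energyForm (g : Metric d M) (m : ℝ) : LinearMap.BilinForm ℝ (TestFunctions d M) :=
  have hadd : ∀ φ φ' χ : TestFunctions d M, dirichletForm g ((φ + φ' : TestFunctions d M) : M → ℝ)
      (χ : M → ℝ) = dirichletForm g φ χ + dirichletForm g φ' χ := fun φ φ' χ => by
    rw [dirichletForm, dirichletForm, dirichletForm,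
      ← integral_add (integrable_gradInner g φ χ) (integrable_gradInner g φ' χ)]
    exact integral_congr_ae (ae_of_all _ fun x => gradInner_add_left g χ x
      (φ.2.1.mdifferentiableAt (by simp)) (φ'.2.1.mdifferentiableAt (by simp)))
  have hsmul : ∀ (c : ℝ) (φ χ : TestFunctions d M),
      dirichletForm g ((c • φ : TestFunctions d M) : M → ℝ) (χ : M → ℝ) =
        c * dirichletForm g φ χ := fun c φ χ => by
    rw [dirichletForm, dirichletForm, ← integral_const_mul]
    exact integral_congr_ae (ae_of_all _ fun x => gradInner_smul_left g c χ x
      (φ.2.1.mdifferentiableAt (by simp)))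
  have hcomm : ∀ φ χ : TestFunctions d M, dirichletForm g (φ : M → ℝ) χ = dirichletForm g χ φ :=
    fun φ χ => integral_congr_ae (ae_of_all _ fun x => gradInner_comm g φ χ x)
  LinearMap.mk₂ ℝ (fun φ χ => dirichletForm g φ χ + m ^ 2 * inner ℝ (toL2 g φ) (toL2 g χ))
    (fun φ φ' χ => by rw [hadd, map_add, inner_add_left]; ring)
    (fun c φ χ => by
      rw [hsmul, map_smul, real_inner_smul_left, smul_eq_mul]; ring)
    (fun φ χ χ' => by rw [hcomm, hadd, map_add, inner_add_right, hcomm χ, hcomm χ']; ring)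
    (fun c φ χ => by
      rw [hcomm, hsmul, map_smul, real_inner_smul_right, smul_eq_mul, hcomm χ]; ring)

theorem energyForm_apply (g : Metric d M) (m : ℝ) (φ χ : TestFunctions d M) :
    energyForm g m φ χ = dirichletForm g φ χ + m ^ 2 * inner ℝ (toL2 g φ) (toL2 g χ) := rfl

/-- `u = C f` in the sense of the closed form `a = energyForm g m`: `u` is the `L²`-limit of an
`a`-Cauchy sequence `φ k` of test functions with `a (φ k) χ → ⟨f, χ⟩` for all `χ`. -/
def IsFormSolution (g : Metric d M) (m : ℝ) (f u : Lp ℝ 2 (vol g)) : Prop :=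
  ∃ φ : ℕ → TestFunctions d M, Tendsto (fun k => toL2 g (φ k)) atTop (𝓝 u) ∧
    Tendsto (fun p : ℕ × ℕ => energyForm g m (φ p.1 - φ p.2) (φ p.1 - φ p.2)) atTop (𝓝 0) ∧
    ∀ χ, Tendsto (fun k => energyForm g m (φ k) χ) atTop (𝓝 (inner ℝ f (toL2 g χ)))

theorem exists_covarianceOperator (g : Metric d M) {m : ℝ} (hm : 0 < m) :
    ∃ C : Lp ℝ 2 (vol g) →L[ℝ] Lp ℝ 2 (vol g), ∀ f u, IsFormSolution g m f u ↔ u = C f := by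
  refine exists_inverse_of_form (energyForm g m) (fun φ χ => ?_) (fun φ => ?_) (toL2 g)
    (c := m ^ 2) (by positivity) (fun φ => ?_)
  · rw [energyForm_apply, energyForm_apply, real_inner_comm]
    congr 1
    exact integral_congr_ae (ae_of_all _ fun x => gradInner_comm g φ χ x)
  · rw [energyForm_apply, real_inner_self_eq_norm_sq]
    have := dirichletForm_self_nonneg g φ
    positivity
  · rw [energyForm_apply, real_inner_self_eq_norm_sq]
    linarith [dirichletForm_self_nonneg g φ]

/-- The definition of the Laplacian by the Dirichlet form, with the term `m²` moved to the left-hand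
side of the equation; along an `L²`-convergent sequence the two forms are Cauchy simultaneously. -/
theorem hasNegLaplacian_iff (g : Metric d M) (m : ℝ) (f : TestFunctions d M)
    (u : Lp ℝ 2 (vol g)) :
    HasNegLaplacian g u (fun x => f.1 x - m ^ 2 * u x) ↔ IsFormSolution g m (toL2 g f) u := by
  have hL2 : ∀ φ : ℕ → TestFunctions d M,
      Tendsto (fun k => eLpNorm ((φ k : M → ℝ) - (u : M → ℝ)) 2 (vol g)) atTop (𝓝 0) ↔
        Tendsto (fun k => toL2 g (φ k)) atTop (𝓝 u) := fun φ => by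
    rw [Lp.tendsto_Lp_iff_tendsto_eLpNorm']
    refine tendsto_congr fun k => eLpNorm_congr_ae ?_
    filter_upwards [coeFn_toL2 g (φ k)] with x hx
    simp [hx]
  have hcauchy : ∀ φ : ℕ → TestFunctions d M, Tendsto (fun k => toL2 g (φ k)) atTop (𝓝 u) →
      Tendsto (fun p : ℕ × ℕ => m ^ 2 * inner ℝ (toL2 g (φ p.1 - φ p.2))
        (toL2 g (φ p.1 - φ p.2))) atTop (𝓝 0) := fun φ h => by
    have h1 := ((cauchySeq_iff_tendsto_dist_atTop_0.1 h.cauchySeq).pow 2).const_mul (m ^ 2)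
    simp only [ne_eq, OfNat.ofNat_ne_zero, not_false_eq_true, zero_pow, mul_zero] at h1
    refine h1.congr fun p => ?_
    rw [real_inner_self_eq_norm_sq, dist_eq_norm, map_sub]
  have hweak : ∀ χ : TestFunctions d M, ∫ x, (f.1 x - m ^ 2 * u x) * χ.1 x ∂(vol g) =
      inner ℝ (toL2 g f) (toL2 g χ) - m ^ 2 * inner ℝ u (toL2 g χ) := fun χ => by
    rw [inner_toL2 g u, inner_toL2 g (toL2 g f), ← integral_const_mul, ← integral_sub]
    · refine integral_congr_ae ?_
      filter_upwards [coeFn_toL2 g f] with x hx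
      rw [hx]
      ring
    · exact (Lp.memLp _).integrable_mul (memLp_testFunction g χ)
    · exact ((Lp.memLp _).integrable_mul (memLp_testFunction g χ)).const_mul _
  constructor
  · rintro ⟨-, -, φ, h1, h2, h3⟩
    have h1' := (hL2 φ).1 h1
    refine ⟨φ, h1', ?_, fun χ => ?_⟩
    · simpa only [energyForm_apply, add_zero] using h2.add (hcauchy φ h1')
    · have h4 := (h3 χ).add ((h1'.inner (tendsto_const_nhds (x := toL2 g χ))).const_mul (m ^ 2))
      simp only [hweak χ, sub_add_cancel] at h4
      exact h4
  · rintro ⟨φ, h1, h2, h3⟩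
    refine ⟨Lp.memLp u, (memLp_testFunction g f).sub ((Lp.memLp u).const_mul _), φ, (hL2 φ).2 h1,
      ?_, fun χ => ?_⟩
    · simpa only [energyForm_apply, add_sub_cancel_right, sub_zero] using h2.sub (hcauchy φ h1)
    · have h4 := (h3 χ).sub ((h1.inner (tendsto_const_nhds (x := toL2 g χ))).const_mul (m ^ 2))
      rw [hweak χ]
      simpa only [energyForm_apply, add_sub_cancel_right] using h4

/-- Substitution of `ψ⁻¹` in square-integrable functions, for an isometry `ψ`. -/
def pushL2 {g : Metric d M} {ψ : Diffeomorph (𝓡 d) (𝓡 d) M M ∞} (hψ : IsIsometry g ψ) :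
    Lp ℝ 2 (vol g) →ₗᵢ[ℝ] Lp ℝ 2 (vol g) :=
  Lp.compMeasurePreservingₗᵢ ℝ ψ.symm (measurePreserving_of_isIsometry (isIsometry_symm hψ))

theorem toL2_push {g : Metric d M} {ψ : Diffeomorph (𝓡 d) (𝓡 d) M M ∞} (hψ : IsIsometry g ψ)
    (φ : TestFunctions d M) : toL2 g (push ψ φ) = pushL2 hψ (toL2 g φ) := rfl

theorem dirichletForm_push {g : Metric d M} {ψ : Diffeomorph (𝓡 d) (𝓡 d) M M ∞}
    (hψ : IsIsometry g ψ) (φ χ : TestFunctions d M) :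
    dirichletForm g (push ψ φ) (push ψ χ) = dirichletForm g φ χ := by
  have h := (measurePreserving_of_isIsometry hψ).integral_comp
    ψ.toHomeomorph.measurableEmbedding (gradInner g (push ψ φ) (push ψ χ))
  rw [dirichletForm, ← h, dirichletForm]
  exact integral_congr_ae (ae_of_all _ fun x => gradInner_comp_symm hψ
    (φ.2.1.mdifferentiable (by simp)) (χ.2.1.mdifferentiable (by simp)) x)

theorem energyForm_push {g : Metric d M} {ψ : Diffeomorph (𝓡 d) (𝓡 d) M M ∞}
    (hψ : IsIsometry g ψ) (m : ℝ) (φ χ : TestFunctions d M) :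
    energyForm g m (push ψ φ) (push ψ χ) = energyForm g m φ χ := by
  rw [energyForm_apply, energyForm_apply, dirichletForm_push hψ, toL2_push hψ, toL2_push hψ,
    LinearIsometry.inner_map_map]

/-- Solving `(-Δ + m²) u = f` commutes with isometries. -/
theorem IsFormSolution.push {g : Metric d M} {ψ : Diffeomorph (𝓡 d) (𝓡 d) M M ∞}
    (hψ : IsIsometry g ψ) {m : ℝ} {f u : Lp ℝ 2 (vol g)} (h : IsFormSolution g m f u) :
    IsFormSolution g m (pushL2 hψ f) (pushL2 hψ u) := by
  obtain ⟨φ, h1, h2, h3⟩ := h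
  refine ⟨fun k => FreeField.push ψ (φ k), ?_, ?_, fun χ => ?_⟩
  · exact ((pushL2 hψ).continuous.tendsto u).comp h1
  · exact h2.congr fun p => (energyForm_push hψ m (φ p.1 - φ p.2) (φ p.1 - φ p.2)).symm
  · obtain ⟨χ, rfl⟩ := (pushEquiv ψ).surjective χ
    have h4 := h3 χ
    change Tendsto (fun k => energyForm g m (FreeField.push ψ (φ k)) (FreeField.push ψ χ)) atTop
      (𝓝 (inner ℝ (pushL2 hψ f) (toL2 g (FreeField.push ψ χ))))
    rw [toL2_push hψ, LinearIsometry.inner_map_map]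
    exact h4.congr fun k => (energyForm_push hψ m (φ k) χ).symm

/-- The covariance is the quadratic form of a bounded operator on `L²(M)` that commutes with
isometries. -/
theorem exists_operator_cov (g : Metric d M) {m : ℝ} (hm : 0 < m) :
    ∃ C : Lp ℝ 2 (vol g) →L[ℝ] Lp ℝ 2 (vol g),
      (∀ f h, cov g m f h = inner ℝ (C (toL2 g h)) (toL2 g f)) ∧
      ∀ ψ (hψ : IsIsometry g ψ) f, C (pushL2 hψ f) = pushL2 hψ (C f) := by
  obtain ⟨C, hC⟩ := exists_covarianceOperator g hm
  refine ⟨C, fun f h => ?_, fun ψ hψ f => ?_⟩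
  · have hex : ∃ u : Lp ℝ 2 (vol g), HasNegLaplacian g u fun x => h.1 x - m ^ 2 * u x :=
      ⟨C (toL2 g h), (hasNegLaplacian_iff g m h _).2 ((hC _ _).2 rfl)⟩
    have hfree : freeCovariance g m h.1 = C (toL2 g h) :=
      (hC _ _).1 ((hasNegLaplacian_iff g m h _).1 (Classical.epsilon_spec hex))
    rw [cov, hfree, inner_toL2]
    simp only [mul_comm]
  · exact ((hC _ _).1 (((hC f (C f)).2 rfl).push hψ)).symm

end Covariance

/-! ### Convergence of transported test functions -/

/-- If homeomorphisms `θ n` of a locally compact, locally connected space converge to the identity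
in the compact-open topology, then the preimages `(θ n)⁻¹ K` of a compact set eventually stay in a
fixed compact set. A connected neighbourhood `V` of a point, compactly contained in a relatively
compact open set `U`, eventually does not meet `θ n (∂U)`, which forces `(θ n)⁻¹ V ⊆ U`. -/
theorem exists_compact_eventually_preimage_subset {M : Type*} [TopologicalSpace M] [T2Space M]
    [LocallyCompactSpace M] [LocallyConnectedSpace M] {θ : ℕ → M ≃ₜ M}
    (hθ : Tendsto (fun n => (⟨θ n, (θ n).continuous⟩ : C(M, M))) atTop (𝓝 (ContinuousMap.id M)))
    {K : Set M} (hK : IsCompact K) :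
    ∃ L, IsCompact L ∧ ∀ᶠ n in atTop, θ n ⁻¹' K ⊆ L := by
  refine hK.induction_on (p := fun s => ∃ L, IsCompact L ∧ ∀ᶠ n in atTop, θ n ⁻¹' s ⊆ L)
    ⟨∅, isCompact_empty, by simp⟩ ?_ ?_ ?_
  · rintro s t hst ⟨L, hL, h⟩
    exact ⟨L, hL, h.mono fun n hn => (Set.preimage_mono hst).trans hn⟩
  · rintro s t ⟨L, hL, h⟩ ⟨L', hL', h'⟩
    refine ⟨L ∪ L', hL.union hL', ?_⟩
    filter_upwards [h, h'] with n hn hn'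
    rw [Set.preimage_union]
    exact Set.union_subset_union hn hn'
  · intro y hy
    obtain ⟨N, hN, hyN⟩ := exists_compact_mem_nhds y
    set U := interior N with hU
    have hyU : y ∈ U := mem_interior_iff_mem_nhds.2 hyN
    have hUN : closure U ⊆ N := closure_minimal interior_subset hN.isClosed
    obtain ⟨N', hyN', hN'U, hN'⟩ := local_compact_nhds (isOpen_interior.mem_nhds hyU)
    obtain ⟨V, ⟨hVopen, hyV, hVconn⟩, hVN'⟩ :=
      (locallyConnectedSpace_iff_hasBasis_isOpen_isConnected.1 inferInstance y).mem_iff.1 hyN'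
    refine ⟨V, mem_nhdsWithin_of_mem_nhds (hVopen.mem_nhds hyV), N, hN, ?_⟩
    have hfr : IsCompact (frontier U) := hN.of_isClosed_subset isClosed_frontier
      (frontier_subset_closure.trans hUN)
    have hfrN' : Set.MapsTo (ContinuousMap.id M) (frontier U) N'ᶜ := fun z hz hzN' => by
      rw [hU, isOpen_interior.frontier_eq] at hz
      exact hz.2 (hN'U hzN')
    have h1 := hθ.eventually (ContinuousMap.eventually_mapsTo hfr hN'.isClosed.isOpen_compl hfrN')
    have h2 : ∀ᶠ n in atTop, θ n y ∈ V := by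
      have hy : Tendsto (fun n => θ n y) atTop (𝓝 y) :=
        ((continuous_eval_const (F := C(M, M)) y).tendsto (ContinuousMap.id M)).comp hθ
      exact hy.eventually (hVopen.mem_nhds hyV)
    filter_upwards [h1, h2] with n hn hny
    have hpre : IsPreconnected (θ n ⁻¹' V) := by
      rw [← (θ n).image_symm]
      exact hVconn.isPreconnected.image _ (θ n).symm.continuous.continuousOn
    have hsub : θ n ⁻¹' V ⊆ U ∪ (closure U)ᶜ := fun z hz => by
      by_contra hcon
      rw [Set.mem_union, not_or, Set.mem_compl_iff, not_not] at hcon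
      have hzfr : z ∈ frontier U := by
        rw [isOpen_interior.frontier_eq]
        exact ⟨hcon.2, hcon.1⟩
      exact hn hzfr (hVN' hz)
    have hU' := hpre.subset_left_of_subset_union isOpen_interior isClosed_closure.isOpen_compl
      (disjoint_compl_right.mono_left subset_closure) hsub ⟨y, hny, hyU⟩
    exact hU'.trans interior_subset

section Convergence

variable {d : ℕ} {M : Type*} [TopologicalSpace M] [T2Space M]
  [ChartedSpace (EuclideanSpace ℝ (Fin d)) M] [IsManifold (𝓡 d) ∞ M] [MeasurableSpace M]
  [BorelSpace M]

/-- Test functions transported by convergent isometries converge in `L²(M)`. As each `ψ n`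
preserves the volume, it is enough to compare `f` with `f ∘ ψ'⁻¹ ∘ ψ n`, which converges pointwise
with supports in a fixed compact set. -/
theorem tendsto_toL2_push (g : Metric d M) {ψ : ℕ → Diffeomorph (𝓡 d) (𝓡 d) M M ∞}
    {ψ' : Diffeomorph (𝓡 d) (𝓡 d) M M ∞} (hψ : ∀ n, IsIsometry g (ψ n))
    (hlim : Tendsto (fun n => (⟨ψ n, (ψ n).continuous⟩ : C(M, M))) atTop
      (𝓝 (⟨ψ', ψ'.continuous⟩ : C(M, M)))) (f : TestFunctions d M) :
    Tendsto (fun n => toL2 g (push (ψ n) f)) atTop (𝓝 (toL2 g (push ψ' f))) := by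
  have hlc : LocallyCompactSpace M := ChartedSpace.locallyCompactSpace (EuclideanSpace ℝ (Fin d)) M
  have hlconn : LocallyConnectedSpace M :=
    ChartedSpace.locallyConnectedSpace (EuclideanSpace ℝ (Fin d)) M
  have hvol := isLocallyFiniteMeasure_vol g
  let θ : ℕ → M ≃ₜ M := fun n => (ψ n).toHomeomorph.trans ψ'.symm.toHomeomorph
  have hθ : Tendsto (fun n => (⟨θ n, (θ n).continuous⟩ : C(M, M))) atTop
      (𝓝 (ContinuousMap.id M)) := by
    have h := ((ContinuousMap.continuous_postcomp
      (⟨ψ'.symm, ψ'.symm.continuous⟩ : C(M, M))).tendsto _).comp hlim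
    have hid : (⟨ψ'.symm, ψ'.symm.continuous⟩ : C(M, M)).comp ⟨ψ', ψ'.continuous⟩ =
        ContinuousMap.id M := ContinuousMap.ext fun x => ψ'.symm_apply_apply x
    rw [hid] at h
    exact h
  let F : ℕ → TestFunctions d M := fun n => push (ψ n).symm (push ψ' f)
  have hF : ∀ n x, (F n).1 x = f.1 (θ n x) := fun n x => rfl
  have hnorm : ∀ n, ‖toL2 g (push (ψ n) f) - toL2 g (push ψ' f)‖ = ‖toL2 g (F n - f)‖ := fun n => by
    have h1 : push ψ' f = push (ψ n) (F n) := ((pushEquiv (ψ n)).apply_symm_apply _).symm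
    rw [h1, toL2_push (hψ n), toL2_push (hψ n), ← map_sub, LinearIsometry.norm_map, norm_sub_rev,
      map_sub]
  rw [tendsto_iff_norm_sub_tendsto_zero]
  simp only [hnorm]
  obtain ⟨L, hL, hsupp⟩ := exists_compact_eventually_preimage_subset hθ f.2.2
  obtain ⟨B, hB⟩ := f.2.2.exists_bound_of_continuous f.2.1.continuous
  have hint : Tendsto (fun n => ∫ x, ((F n).1 x - f.1 x) ^ 2 ∂(vol g)) atTop
      (𝓝 (∫ _, (0 : ℝ) ∂(vol g))) := by
    refine tendsto_integral_filter_of_dominated_convergence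
      ((L ∪ tsupport f.1).indicator fun _ => (2 * B) ^ 2) ?_ ?_ ?_ ?_
    · exact Eventually.of_forall fun n =>
        (((F n).2.1.continuous.sub f.2.1.continuous).pow 2).measurable.aestronglyMeasurable
    · filter_upwards [hsupp] with n hn
      refine ae_of_all _ fun x => ?_
      by_cases hx : x ∈ L ∪ tsupport f.1
      · rw [Set.indicator_of_mem hx, Real.norm_of_nonneg (sq_nonneg _), hF]
        have h1 := abs_le.1 (hB (θ n x))
        have h2 := abs_le.1 (hB x)
        exact sq_le_sq' (by linarith) (by linarith)
      · rw [Set.indicator_of_notMem hx, hF]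
        have h1 : f.1 x = 0 := image_eq_zero_of_notMem_tsupport fun h => hx (Or.inr h)
        have h2 : f.1 (θ n x) = 0 := image_eq_zero_of_notMem_tsupport fun h => hx (Or.inl (hn h))
        simp [h1, h2]
    · have hc : IsCompact (L ∪ tsupport f.1) := hL.union f.2.2
      exact (integrable_indicator_iff hc.measurableSet).2
        (integrableOn_const hc.measure_lt_top.ne)
    · refine ae_of_all _ fun x => ?_
      have h1 : Tendsto (fun n => θ n x) atTop (𝓝 x) :=
        ((continuous_eval_const (F := C(M, M)) x).tendsto (ContinuousMap.id M)).comp hθ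
      have h2 := (((f.2.1.continuous.tendsto x).comp h1).sub_const (f.1 x)).pow 2
      simpa [hF] using h2
  rw [integral_zero] at hint
  have hsqrt := hint.sqrt
  rw [Real.sqrt_zero] at hsqrt
  refine hsqrt.congr fun n => ?_
  have h3 : ∫ x, ((F n).1 x - f.1 x) ^ 2 ∂(vol g) = ‖toL2 g (F n - f)‖ ^ 2 := by
    rw [← real_inner_self_eq_norm_sq, inner_toL2]
    refine integral_congr_ae ?_
    filter_upwards [coeFn_toL2 g (F n - f)] with x hx
    rw [hx, sq]
    rfl
  rw [h3, Real.sqrt_sq (norm_nonneg _)]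

end Convergence

end

end FreeField

theorem mainTheorem11 {d : ℕ} {M : Type*} [TopologicalSpace M] [T2Space M] [ParacompactSpace M]
    [ConnectedSpace M] [ChartedSpace (EuclideanSpace ℝ (Fin d)) M] [IsManifold (𝓡 d) ∞ M]
    [MeasurableSpace M] [BorelSpace M] (g : FreeField.Metric d M) (m : ℝ) (hm : 0 < m)
    {X : Type*} [MeasurableSpace X] (μ : Measure X) [IsProbabilityMeasure μ]
    (Φ : FreeField.TestFunctions d M →ₗ[ℝ] (X → ℝ)) (hΦ : FreeField.IsFreeField g m μ Φ)
    (ψ : ℕ → Diffeomorph (𝓡 d) (𝓡 d) M M ∞) (ψ' : Diffeomorph (𝓡 d) (𝓡 d) M M ∞)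
    (hψ : ∀ n, FreeField.IsIsometry g (ψ n))
    (hlim : Tendsto (fun n => (⟨ψ n, (ψ n).continuous⟩ : C(M, M))) atTop
      (𝓝 (⟨ψ', ψ'.continuous⟩ : C(M, M)))) :
    (∀ n, (∃! T, FreeField.IsInducedOperator g m μ Φ (ψ n) T) ∧
      FreeField.inducedOperator g m μ Φ (ψ n) ∈ unitary (Lp ℂ 2 μ →L[ℂ] Lp ℂ 2 μ)) ∧
    ((∃! T, FreeField.IsInducedOperator g m μ Φ ψ' T) ∧
      FreeField.inducedOperator g m μ Φ ψ' ∈ unitary (Lp ℂ 2 μ →L[ℂ] Lp ℂ 2 μ)) ∧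
    ∀ A : Lp ℂ 2 μ, Tendsto (fun n => FreeField.inducedOperator g m μ Φ (ψ n) A) atTop
      (𝓝 (FreeField.inducedOperator g m μ Φ ψ' A)) := by
  obtain ⟨C, hC, hCψ⟩ := FreeField.exists_operator_cov g hm
  have hpush := FreeField.tendsto_toL2_push g hψ hlim
  have hinv : ∀ n f h, FreeField.cov g m (FreeField.push (ψ n) f) (FreeField.push (ψ n) h) =
      FreeField.cov g m f h := fun n f h => by
    rw [hC, hC, FreeField.toL2_push (hψ n), FreeField.toL2_push (hψ n), hCψ,
      LinearIsometry.inner_map_map]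
  refine FreeField.strong_continuity_of_cov hΦ (fun t f => ?_) hinv (fun f h => ?_) (fun f => ?_)
  · rw [hC, hC, map_smul, map_smul, real_inner_smul_left, real_inner_smul_right]
    ring
  · -- The limit inherits the invariance of the covariance, by continuity of `C`.
    have h1 := ((C.continuous.tendsto _).comp (hpush h)).inner (𝕜 := ℝ) (hpush f)
    rw [hC]
    refine tendsto_nhds_unique h1 (tendsto_const_nhds.congr fun n => ?_)
    rw [← hinv n, hC]
    rfl
  · have h1 := (hpush f).sub_const (FreeField.toL2 g (FreeField.push ψ' f))
    have h2 := ((C.continuous.tendsto _).comp h1).inner (𝕜 := ℝ) h1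
    simp only [sub_self, map_zero, inner_zero_left] at h2
    refine h2.congr fun n => ?_
    rw [hC, map_sub]
    rfl
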